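/- Let $D\ge 3$ be odd and let $S=\{1,\dots,2D\}$. Let $X$ be the set of unordered pairs $\{u,S\setminus u\}$, $u\subseteq S$. For $x,y\in X$ let $\delta(x,y)=\min\{|u\,\triangle\, v| : u\in x,\ v\in y\}$. The folded cube $\square_{2D}$ is the graph with vertex set $X$ in which $x,y$ are adjacent if and only if $\delta(x,y)=1$; let $\partial$ be its path-length distance. Put $\mathbf 0=\{\emptyset,S\}$. Let $T\subseteq \mathrm{Mat}_X(\mathbb C)$ be the Terwilliger algebra of $\square_{2D}$ with respect to $\mathbf 0$, that is, the subalgebra generated by the distance matrices $A_i$, $(A_i)_{xy}=1$ if $\partial(x,y)=i$ and $0$ otherwise, and the diagonal matrices $E_i^*$, $(E_i^*)_{xx}=1$ if $\partial(\mathbf 0,x)=i$ and $0$ otherwise. Let $M^t_{i,j}\in\mathrm{Mat}_X(\mathbb C)$ be the zero-one matrix whose $(x,y)$-entry is $1$ if and only if $\delta(\mathbf 0,x)=i$, $\delta(\mathbf 0,y)=j$ and $t=\max\{|u\cap v| : u\in x,\ |u|=i,\ v\in y,\ |v|=j\}$. For $0\le r\le D-1$ let $$\mathcal L_r=\{\xi\in\mathbb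 C^X : M^{r-1}_{r-1,r}\,\xi=0,\ \xi_x=0 \text{ if } \delta(\mathbf 0,x)\ne r\}$$ (the first condition is void for $r=0$), let $B_r$ be any orthonormal basis of $\mathcal L_r$, and let $N_r=\{r,r+1,\dots,D\}$ if $r$ is even and $N_r=\{r,r+1,\dots,D-1\}$ if $r$ is odd. Let $\mathcal B_2=\{(r,\xi,i): 0\le r\le D-1,\ \xi\in B_r,\ i\in N_r\}$ and let $U_2$ be the $X\times\mathcal B_2$ matrix whose $(r,\xi,i)$-th column is $$u_{r,\xi,i}=\binom{2D-2r}{i-r}^{-1/2}M^r_{i,r}\xi\quad (r\le i\le D-1),$$ $$u_{r,\xi,D}=\tfrac{\sqrt2}{2}\binom{2D-2r}{D-r}^{-1/2}M^r_{D,r}\xi\quad (r>0 \text{ even}),\qquad u_{0,\xi,D}=\sqrt2\,\binom{2D}{D}^{-1/2}M^0_{D,0}\xi .$$ Then $U_2$ block-diagonalizes $T$, and $T\cong\bigoplus_{r=0}^{D-1}\mathbb C^{N_r\times N_r}$. Precisely: 1. $U_2$ is unitary: $U_2^*U_2=I$ and $U_2U_2^*=I$, where ${}^*$ is the conjugate transpose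 (which is the transpose if the bases $B_r$ are real). 2. $|B_r|=\binom{2D}{r}-\binom{2D}{r-1}$ for $0\le r\le D-1$, where $\binom{2D}{-1}=0$. 3. There is an isomorphism of $\mathbb C$-algebras $\Phi=(\Phi_r)_r: T\to\bigoplus_{r=0}^{D-1}\mathbb C^{N_r\times N_r}$ such that for every $M\in T$ the matrix $U_2^*MU_2$ is block diagonal with, for each $r$, exactly one copy of the block $\Phi_r(M)$ for every $\xi\in B_r$: its entry at $\big((r,\xi,i),(r',\xi',i')\big)$ is $\Phi_r(M)_{i,i'}$ if $r=r'$ and $\xi=\xi'$, and $0$ otherwise. -/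

import Mathlib

open scoped Matrix Kronecker

noncomputable section

/-! ### The Terwilliger algebra of a finite graph -/

/-- The `i`-th distance matrix of a graph (path-length distance). -/
def distMatrix {V : Type*} (G : SimpleGraph V) (i : ℕ) : Matrix V V ℂ :=
  Matrix.of fun y z => if G.dist y z = i then 1 else 0

open Classical in
/-- The `i`-th dual idempotent of a graph with respect to the vertex `x`. -/
def dualIdempotent {V : Type*} (G : SimpleGraph V) (x : V) (i : ℕ) : Matrix V V ℂ :=
  Matrix.diagonal fun y => if G.dist x y = i then 1 else 0

/-- The Bose-Mesner algebra, as a linear space of matrices. For `i` larger than the diameter of a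
finite connected graph the `i`-th distance matrix is zero, so no bound on `i` is needed. -/
def boseMesner {V : Type*} (G : SimpleGraph V) : Submodule ℂ (Matrix V V ℂ) :=
  Submodule.span ℂ (Set.range (distMatrix G))

/-- The dual Bose-Mesner algebra with respect to `x`, as a linear space of matrices. -/
def dualBoseMesner {V : Type*} (G : SimpleGraph V) (x : V) : Submodule ℂ (Matrix V V ℂ) :=
  Submodule.span ℂ (Set.range (dualIdempotent G x))

/-- The Terwilliger algebra with respect to `x`: the subalgebra of the full matrix algebra
generated by the Bose-Mesner algebra and the dual Bose-Mesner algebra. -/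
def terwilligerAlgebra {V : Type*} [Fintype V] [DecidableEq V] (G : SimpleGraph V) (x : V) :
    Subalgebra ℂ (Matrix V V ℂ) :=
  Algebra.adjoin ℂ ((boseMesner G : Set (Matrix V V ℂ)) ∪ dualBoseMesner G x)

/-! ### The folded cube -/

/-- Vertices of the folded `n`-cube: the unordered pairs `{u, uᶜ}` of complementary subsets of an
`n`-element set. -/
abbrev FoldedVertex (n : ℕ) : Type :=
  {p : Finset (Finset (Fin n)) // ∃ u : Finset (Fin n), p = {u, uᶜ}}

namespace FoldedVertex

/-- The vertex `{∅, S}`. -/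
def zero (n : ℕ) : FoldedVertex n := ⟨{∅, ∅ᶜ}, ∅, rfl⟩

/-- `min {|u ∆ v|}`, where `u` runs over the two sides of `x` and `v` over the two sides of `y`. -/
def sep {n : ℕ} (x y : FoldedVertex n) : ℕ :=
  sInf {m | ∃ u ∈ x.1, ∃ v ∈ y.1, m = (symmDiff u v).card}

theorem sep_comm {n : ℕ} (x y : FoldedVertex n) : sep x y = sep y x := by
  unfold sep
  congr 1
  ext m
  constructor
  · rintro ⟨u, hu, v, hv, h⟩
    exact ⟨v, hv, u, hu, by rw [h, symmDiff_comm]⟩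
  · rintro ⟨u, hu, v, hv, h⟩
    exact ⟨v, hv, u, hu, by rw [h, symmDiff_comm]⟩

theorem sep_self {n : ℕ} (x : FoldedVertex n) : sep x x = 0 := by
  obtain ⟨p, u, rfl⟩ := x
  refine Nat.sInf_eq_zero.2 (Or.inl ⟨u, by simp, u, by simp, by simp⟩)

end FoldedVertex

/-- The folded `n`-cube. -/
def foldedCube (n : ℕ) : SimpleGraph (FoldedVertex n) where
  Adj x y := FoldedVertex.sep x y = 1
  symm := ⟨fun x y h => by rw [FoldedVertex.sep_comm]; exact h⟩
  loopless := ⟨fun x h => by rw [FoldedVertex.sep_self] at h; exact absurd h (by norm_num)⟩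

/-! ### The zero-one matrices `M^t_{i,j}` and the spaces `L_r` for the folded `2D`-cube -/

/-- The relation `∂(0, x, y) = (i, j, t)`: the vertices `x` and `y` are at distance `i` and `j` from
`{∅, S}`, and `t` is the largest value of `|u ∩ v|` over the sides `u` of `x` with `|u| = i` and the
sides `v` of `y` with `|v| = j`. A vertex at distance less than `D` has a unique such side; for a
vertex at distance `D` both sides qualify. -/
def tripleRel (D i j t : ℕ) (x y : FoldedVertex (2 * D)) : Prop :=
  FoldedVertex.sep (FoldedVertex.zero (2 * D)) x = i ∧
  FoldedVertex.sep (FoldedVertex.zero (2 * D)) y = j ∧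
  IsGreatest {m | ∃ u ∈ x.1, ∃ v ∈ y.1, u.card = i ∧ v.card = j ∧ m = (u ∩ v).card} t

open Classical in
/-- The zero-one matrix `M^t_{i,j}`, written `orbitMatrix D i j t`. -/
def orbitMatrix (D i j t : ℕ) : Matrix (FoldedVertex (2 * D)) (FoldedVertex (2 * D)) ℂ :=
  Matrix.of fun x y => if tripleRel D i j t x y then 1 else 0

/-- The space `L_r` of the vectors `ξ` supported on the vertices at distance `r` from `{∅, S}` with
`M^{r-1}_{r-1,r} ξ = 0` (no condition of the second kind if `r = 0`). -/
def lowestSpace (D r : ℕ) : Submodule ℂ (EuclideanSpace ℂ (FoldedVertex (2 * D))) where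
  carrier := {ξ | (∀ k, k + 1 = r → orbitMatrix D k r k *ᵥ ξ.ofLp = 0) ∧
    ∀ x, FoldedVertex.sep (FoldedVertex.zero (2 * D)) x ≠ r → ξ x = 0}
  zero_mem' := ⟨fun _ _ => by simp, fun _ _ => rfl⟩
  add_mem' := by
    rintro a b ⟨ha, ha'⟩ ⟨hb, hb'⟩
    refine ⟨fun k hk => ?_, fun x hx => ?_⟩
    · rw [WithLp.ofLp_add, Matrix.mulVec_add, ha k hk, hb k hk, add_zero]
    · rw [PiLp.add_apply, ha' x hx, hb' x hx, add_zero]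
  smul_mem' := by
    rintro c a ⟨ha, ha'⟩
    refine ⟨fun k hk => ?_, fun x hx => ?_⟩
    · rw [WithLp.ofLp_smul, Matrix.mulVec_smul, ha k hk, smul_zero]
    · rw [PiLp.smul_apply, ha' x hx, smul_zero]

/-! ### The matrix `U₂` -/

/-- `N_r = {r, …, D}` for even `r` and `N_r = {r, …, D - 1}` for odd `r`, as an index type. -/
abbrev BlockIndex (D r : ℕ) : Type :=
  ↥(Finset.Icc r (if Even r then D else D - 1))

/-- The index set of the triples `(r, ξ, i)` with `0 ≤ r ≤ D - 1`, `ξ` in a basis of `L_r` (indexed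
by `ι r`) and `i ∈ N_r`. -/
abbrev TripleIndex (D : ℕ) (ι : Fin D → Type*) : Type _ :=
  (r : Fin D) × (ι r × BlockIndex D r)

/-- The factor that normalizes `M^r_{i,r} ξ`, for a unit vector `ξ` of `L_r`. -/
def normFactor (D r i : ℕ) : ℝ :=
  if i = D then
    (if r = 0 then √2 else √2 / 2) * (√((2 * D - 2 * r).choose (D - r) : ℝ))⁻¹
  else (√((2 * D - 2 * r).choose (i - r) : ℝ))⁻¹

/-- The matrix `U₂` attached to orthonormal bases of the spaces `L_r`: its `(r, ξ, i)`-th column is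
the vector `u_{r,ξ,i}`, the normalized `M^r_{i,r} ξ`. -/
def basisMatrix (D : ℕ) {ι : Fin D → Type*} [∀ r, Fintype (ι r)]
    (b : ∀ r : Fin D, OrthonormalBasis (ι r) ℂ (lowestSpace D r)) :
    Matrix (FoldedVertex (2 * D)) (TripleIndex D ι) ℂ :=
  Matrix.of fun x c =>
    (normFactor D c.1 c.2.2 : ℂ) *
      (orbitMatrix D c.2.2 c.1 c.1 *ᵥ
        (b c.1 c.2.1 : EuclideanSpace ℂ (FoldedVertex (2 * D))).ofLp) x

/-- The block diagonal matrix in which, for every `r`, the block `C r` is repeated once for each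
element of `ι r`: the entry at `((r, ξ, i), (r', ξ', i'))` is `C r i i'` if `r = r'` and `ξ = ξ'`,
and `0` otherwise. -/
def repeatedBlocks (D : ℕ) {ι : Fin D → Type*} [∀ r, DecidableEq (ι r)]
    (C : ∀ r : Fin D, Matrix (BlockIndex D r) (BlockIndex D r) ℂ) :
    Matrix (TripleIndex D ι) (TripleIndex D ι) ℂ :=
  Matrix.blockDiagonal' fun r => (1 : Matrix (ι r) (ι r) ℂ) ⊗ₖ C r

end

/-! A vector of `lowestSpace D r`, read on the `r`-subsets of `S`, is a harmonic function `h`, and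
up to a scalar its columns in `basisMatrix` are the restrictions of one function `H u = ∑ v ⊆ u, h
v` to the levels `|u| = i`. Everything follows from how `H` behaves when `u` loses a point, gains a
point or is complemented.

With `n` points, the sum of `H` over all deletions is `(|u| - r) H u` (`sum_subsetSum_erase`), over
all insertions `(n - |u| - r) H u` (`sum_subsetSum_insert`), and `H uᶜ = (-1)^r H u`
(`subsetSum_compl`). Deletion and insertion are adjoint, so on each level functions of different `r`
are orthogonal, and for equal `r` the inner product on level `r + j` is the original one times `(n -
2r).choose j`. This makes the columns orthonormal. The sign under complementation explains the level
`D`, whose vertices have two sides of equal size: odd `r` has no column there, and for even `r` > 0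
the two sides contribute equally.

Completeness is a count. Rank-nullity bounds each dimension below by a difference of binomials,
orthonormality bounds the number of columns above by `2 ^ (2 * D - 1)`, and for odd `D` the lower
bounds already add up to that number. Hence all bounds are equalities (`card_index_eq`) and the
matrix is unitary.

Finally, the same identities show that the adjacency matrix acts by one block for each `r`,
depending only on `r` (`distMatrix_one_mul_basisMatrix`). The adjacency matrix and the dual
idempotents generate the Terwilliger algebra, since each distance matrix is a polynomial in the
adjacency matrix. Their blocks generate the whole product of matrix algebras (`subalgebra_eq_top`),
because the entries next to the diagonal do not vanish and each block starts at a different level.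
-/

/-! ### Harmonic functions on a Boolean lattice -/

section Harmonic

variable {α : Type*} [Fintype α] [DecidableEq α]

/-- The sum of `h` over the subsets of `u`. -/
noncomputable def subsetSum (h : Finset α → ℂ) (u : Finset α) : ℂ :=
  ∑ v, if v ⊆ u then h v else 0

/-- A function supported on the sets of size `r` whose sum over the supersets of any set of size
`r - 1` vanishes. -/
structure IsHarmonic (r : ℕ) (h : Finset α → ℂ) : Prop where
  support : ∀ v : Finset α, v.card ≠ r → h v = 0
  lower : ∀ w : Finset α, w.card + 1 = r → ∑ v, (if w ⊆ v then h v else 0) = 0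

theorem IsHarmonic.star {r : ℕ} {h : Finset α → ℂ} (hh : IsHarmonic r h) :
    IsHarmonic r (star h) := by
  refine ⟨fun v hv => by simp [hh.support v hv], fun w hw => ?_⟩
  have := congrArg Star.star (hh.lower w hw)
  simpa [star_sum, apply_ite] using this

theorem subsetSum_star (h : Finset α → ℂ) (u : Finset α) :
    subsetSum (star h) u = star (subsetSum h u) := by
  simp [subsetSum, star_sum, apply_ite]

theorem subsetSum_eq_zero_of_card_lt {r : ℕ} {h : Finset α → ℂ} (hh : IsHarmonic r h)
    {u : Finset α} (hu : u.card < r) : subsetSum h u = 0 := by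
  refine Finset.sum_eq_zero fun v _ => ?_
  split_ifs with hv
  · exact hh.support v (by have := Finset.card_le_card hv; omega)
  · rfl

theorem subsetSum_of_card_eq {r : ℕ} {h : Finset α → ℂ} (hh : IsHarmonic r h)
    {u : Finset α} (hu : u.card = r) : subsetSum h u = h u := by
  rw [subsetSum, Finset.sum_eq_single u]
  · simp
  · intro v _ hvu
    split_ifs with hv
    · refine hh.support v fun hr => hvu (Finset.eq_of_subset_of_card_le hv (by omega))
    · rfl
  · simp

/-- An `r`-subset `v` of `u` survives the deletion of exactly the `|u| - r` points of `u \ v`. -/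
theorem sum_subsetSum_erase {r : ℕ} {h : Finset α → ℂ} (hh : IsHarmonic r h) (u : Finset α) :
    ∑ a ∈ u, subsetSum h (u.erase a) = ((u.card : ℂ) - r) * subsetSum h u := by
  simp only [subsetSum]
  rw [Finset.sum_comm, Finset.mul_sum]
  refine Finset.sum_congr rfl fun v _ => ?_
  by_cases hr : v.card = r
  · rw [← Finset.sum_filter, Finset.sum_const, nsmul_eq_mul, mul_ite, mul_zero]
    split_ifs with hv
    · have : u.filter (fun a => v ⊆ u.erase a) = u \ v := by
        ext a
        simp only [Finset.mem_filter, Finset.mem_sdiff, Finset.subset_erase]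
        tauto
      rw [this, Finset.card_sdiff_of_subset hv, Nat.cast_sub (Finset.card_le_card hv), hr]
    · have : u.filter (fun a => v ⊆ u.erase a) = ∅ := by
        ext a
        simp [Finset.subset_erase, hv]
      simp [this]
  · simp [hh.support v hr]

/-- Add the harmonic condition over all `(r - 1)`-subsets of `u`: a set `v ⊆ u` is counted `r`
times, a set meeting `u` in `r - 1` points once, and any other set not at all. -/
theorem sum_inter_card_add_one {r : ℕ} {h : Finset α → ℂ} (hh : IsHarmonic r h)
    (u : Finset α) :
    ∑ v, (if (u ∩ v).card + 1 = r then h v else 0) = -(r : ℂ) * subsetSum h u := by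
  rcases r with _ | k
  · simp
  have key : ∑ w ∈ u.powersetCard k, ∑ v, (if w ⊆ v then h v else 0) = 0 :=
    Finset.sum_eq_zero fun w hw => hh.lower w (by rw [(Finset.mem_powersetCard.1 hw).2])
  rw [Finset.sum_comm] at key
  rw [eq_comm, neg_mul, neg_eq_iff_add_eq_zero]
  refine Eq.trans ?_ key
  rw [subsetSum, Finset.mul_sum, ← Finset.sum_add_distrib]
  refine Finset.sum_congr rfl fun v _ => ?_
  by_cases hr : v.card = k + 1
  · have hcount : (u.powersetCard k).filter (fun w => w ⊆ v) = (u ∩ v).powersetCard k := by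
      ext w
      simp only [Finset.mem_filter, Finset.mem_powersetCard, Finset.subset_inter_iff]
      tauto
    rw [← Finset.sum_filter, hcount, Finset.sum_const, nsmul_eq_mul, Finset.card_powersetCard]
    by_cases hv : v ⊆ u
    · rw [Finset.inter_eq_right.2 hv, hr]
      simp [hv]
    · have hlt : (u ∩ v).card < k + 1 := by
        rw [← hr]
        refine Finset.card_lt_card (Finset.inter_subset_right.ssubset_of_ne fun he => hv ?_)
        exact Finset.inter_eq_right.1 he
      rcases Nat.lt_succ_iff_lt_or_eq.1 hlt with hk | hk
      · rw [Nat.choose_eq_zero_of_lt hk]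
        simp [hv, hk.ne]
      · simp [hk, hv]
  · simp [hh.support v hr]

/-- A set `v ⊆ u` is counted for every inserted point, a set with a single point outside `u` once.
The sets of the second kind sum to `-r` times `subsetSum h u` by `sum_inter_card_add_one`. -/
theorem sum_subsetSum_insert {r : ℕ} {h : Finset α → ℂ} (hh : IsHarmonic r h) (u : Finset α) :
    ∑ a ∈ uᶜ, subsetSum h (insert a u) =
      ((Fintype.card α : ℂ) - u.card - r) * subsetSum h u := by
  have h1 := sum_inter_card_add_one hh u
  have : ((Fintype.card α : ℂ) - u.card - r) * subsetSum h u =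
      ((Fintype.card α : ℂ) - u.card) * subsetSum h u +
        ∑ v, (if (u ∩ v).card + 1 = r then h v else 0) := by rw [h1]; ring
  rw [this]
  simp only [subsetSum]
  rw [Finset.sum_comm, Finset.mul_sum, ← Finset.sum_add_distrib]
  refine Finset.sum_congr rfl fun v _ => ?_
  by_cases hr : v.card = r
  · rw [← Finset.sum_filter, Finset.sum_const, nsmul_eq_mul]
    have hcard := Finset.card_sdiff_add_card_inter v u
    rw [Finset.inter_comm] at hcard
    by_cases hv : v ⊆ u
    · have : uᶜ.filter (fun a => v ⊆ insert a u) = uᶜ :=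
        Finset.filter_true_of_mem fun a _ => hv.trans (Finset.subset_insert a u)
      rw [this, Finset.card_compl, Nat.cast_sub (Finset.card_le_univ u),
        Finset.inter_eq_right.2 hv]
      simp [hv, hr]
    · by_cases h1 : (u ∩ v).card + 1 = r
      · obtain ⟨b, hb⟩ := Finset.card_eq_one.1 (show (v \ u).card = 1 by omega)
        have : uᶜ.filter (fun a => v ⊆ insert a u) = {b} := by
          ext a
          have hs : v ⊆ insert a u ↔ v \ u ⊆ {a} := by
            rw [sdiff_le_iff', Finset.insert_eq, Finset.sup_eq_union]
          have hbu : b ∈ v \ u := by simp [hb]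
          rw [Finset.mem_filter, hs, hb]
          simp only [Finset.mem_compl, Finset.singleton_subset_iff, Finset.mem_singleton]
          constructor
          · exact fun h => h.2.symm
          · rintro rfl
            exact ⟨(Finset.mem_sdiff.1 hbu).2, rfl⟩
        simp [this, hv, h1]
      · have : uᶜ.filter (fun a => v ⊆ insert a u) = ∅ := by
          refine Finset.filter_false_of_mem fun a _ hs => ?_
          have hs : v \ u ⊆ {a} := by
            rwa [sdiff_le_iff', Finset.sup_eq_union, ← Finset.insert_eq]
          have h2 := Finset.card_le_card hs
          rw [Finset.card_singleton] at h2
          have h3 : (v \ u).card ≠ 0 := by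
            rw [Finset.card_ne_zero, Finset.sdiff_nonempty]; exact hv
          omega
        simp [this, hv, h1]
  · simp [hh.support v hr]

/-- Induction downwards from `|s| = r - 1`: summing the vanishing sums over all `insert a s` counts
each `r`-set above `s` exactly `r - |s| ≠ 0` times. -/
theorem sum_superset_eq_zero {r : ℕ} {h : Finset α → ℂ} (hh : IsHarmonic r h)
    (s : Finset α) (hs : s.card < r) : ∑ v, (if s ⊆ v then h v else 0) = 0 := by
  obtain ⟨k, hk⟩ := Nat.exists_eq_add_of_lt hs
  induction k generalizing s with
  | zero => exact hh.lower s (by omega)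
  | succ k ih =>
    have key : ∑ a ∈ sᶜ, ∑ v, (if insert a s ⊆ v then h v else 0) = 0 := by
      refine Finset.sum_eq_zero fun a ha => ih _ ?_ ?_ <;>
      · rw [Finset.card_insert_of_notMem (Finset.mem_compl.1 ha)]; omega
    rw [Finset.sum_comm] at key
    have hne : ((r : ℂ) - s.card) ≠ 0 := by
      rw [sub_ne_zero]; exact_mod_cast (by omega : r ≠ s.card)
    refine (mul_eq_zero.1 ?_).resolve_left hne
    refine Eq.trans ?_ key
    rw [Finset.mul_sum]
    refine Finset.sum_congr rfl fun v _ => ?_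
    by_cases hr : v.card = r
    · rw [← Finset.sum_filter, Finset.sum_const, nsmul_eq_mul, mul_ite, mul_zero]
      split_ifs with hv
      · have : sᶜ.filter (fun a => insert a s ⊆ v) = v \ s := by
          ext a
          simp only [Finset.mem_filter, Finset.mem_sdiff, Finset.insert_subset_iff,
            Finset.mem_compl]
          tauto
        rw [this, Finset.card_sdiff_of_subset hv, Nat.cast_sub (Finset.card_le_card hv), hr]
      · have : sᶜ.filter (fun a => insert a s ⊆ v) = ∅ := by
          ext a
          simp [Finset.insert_subset_iff, hv]
        simp [this]
    · simp [hh.support v hr]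

/-- Inclusion-exclusion over `s ⊆ u ∩ v` detects `v ⊆ uᶜ`. After exchanging the sums, the sets `s`
with fewer than `r` points drop out by `sum_superset_eq_zero`, those with more by the support of
`h`, and `|s| = r` leaves `(-1)^r h s`. -/
theorem subsetSum_compl {r : ℕ} {h : Finset α → ℂ} (hh : IsHarmonic r h) (u : Finset α) :
    subsetSum h uᶜ = (-1) ^ r * subsetSum h u := by
  have h1 : ∑ s ∈ u.powerset, ∑ v, (if s ⊆ v then (-1 : ℂ) ^ s.card * h v else 0) =
      subsetSum h uᶜ := by
    rw [Finset.sum_comm, subsetSum]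
    refine Finset.sum_congr rfl fun v _ => ?_
    have hf : u.powerset.filter (fun s => s ⊆ v) = (u ∩ v).powerset := by
      ext s
      simp only [Finset.mem_filter, Finset.mem_powerset, Finset.subset_inter_iff]
    have h2 := congrArg (Int.cast : ℤ → ℂ) (Finset.sum_powerset_neg_one_pow_card (x := u ∩ v))
    push_cast at h2
    rw [← Finset.sum_filter, hf, ← Finset.sum_mul, h2]
    have : u ∩ v = ∅ ↔ v ⊆ uᶜ := by
      rw [← Finset.disjoint_iff_inter_eq_empty, Finset.subset_compl_iff_disjoint_left]
    simp only [this]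
    split_ifs <;> simp
  have hz : Finset.univ.filter (fun v => v ⊆ u) = u.powerset := by
    ext; simp
  rw [← h1, subsetSum, Finset.mul_sum]
  simp only [mul_ite, mul_zero]
  rw [← Finset.sum_filter, hz]
  · refine Finset.sum_congr rfl fun s _ => ?_
    have h3 : ∑ v, (if s ⊆ v then (-1 : ℂ) ^ s.card * h v else 0) =
        (-1) ^ s.card * ∑ v, (if s ⊆ v then h v else 0) := by
      rw [Finset.mul_sum]; simp
    rw [h3]
    rcases lt_trichotomy s.card r with hs | hs | hs
    · rw [sum_superset_eq_zero hh s hs, hh.support s hs.ne]; simp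
    · rw [Finset.sum_eq_single s, hs]
      · simp
      · intro v _ hvs
        split_ifs with hv
        · exact hh.support v fun hr => hvs (Finset.eq_of_subset_of_card_le hv (by omega)).symm
        · rfl
      · simp
    · rw [hh.support s hs.ne', Finset.sum_eq_zero]
      · simp
      · intro v _
        split_ifs with hv
        · exact hh.support v (by have := Finset.card_le_card hv; omega)
        · rfl

/-- Summing over pairs of nested sets of sizes `k` and `k + 1` in two ways. -/
theorem sum_erase_eq_sum_insert (k : ℕ) (F : Finset α → Finset α → ℂ) :
    ∑ u ∈ Finset.univ.powersetCard (k + 1), ∑ a ∈ u, F (u.erase a) u =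
      ∑ w ∈ Finset.univ.powersetCard k, ∑ a ∈ wᶜ, F w (insert a w) := by
  rw [Finset.sum_sigma', Finset.sum_sigma']
  refine Finset.sum_bij' (fun p _ => ⟨p.1.erase p.2, p.2⟩) (fun p _ => ⟨insert p.2 p.1, p.2⟩)
    ?_ ?_ ?_ ?_ ?_
  · rintro ⟨u, a⟩ h
    simp only [Finset.mem_sigma, Finset.mem_powersetCard, Finset.mem_compl] at h ⊢
    rw [Finset.card_erase_of_mem h.2]
    exact ⟨⟨Finset.subset_univ _, by omega⟩, by simp⟩
  · rintro ⟨u, a⟩ h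
    simp only [Finset.mem_sigma, Finset.mem_powersetCard, Finset.mem_compl] at h ⊢
    rw [Finset.card_insert_of_notMem h.2]
    exact ⟨⟨Finset.subset_univ _, by omega⟩, by simp⟩
  · rintro ⟨u, a⟩ h
    simp only [Finset.mem_sigma] at h
    simp [Finset.insert_erase h.2]
  · rintro ⟨u, a⟩ h
    simp only [Finset.mem_sigma, Finset.mem_compl] at h
    simp [Finset.erase_insert h.2]
  · rintro ⟨u, a⟩ h
    simp only [Finset.mem_sigma] at h
    simp [Finset.insert_erase h.2]

/-- Deletion acting on `subsetSum h` is adjoint to insertion acting on `subsetSum g`; both are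
scalars on subset sums. The pairing is bilinear; conjugation enters later through `IsHarmonic.star`.
-/
theorem sum_subsetSum_mul_succ {r s : ℕ} {h g : Finset α → ℂ} (hh : IsHarmonic r h)
    (hg : IsHarmonic s g) (k : ℕ) :
    ((k : ℂ) + 1 - r) * ∑ u ∈ Finset.univ.powersetCard (k + 1), subsetSum h u * subsetSum g u =
      ((Fintype.card α : ℂ) - k - s) *
        ∑ u ∈ Finset.univ.powersetCard k, subsetSum h u * subsetSum g u := by
  have key := sum_erase_eq_sum_insert k (fun w u : Finset α => subsetSum h w * subsetSum g u)
  simp only [← Finset.sum_mul, ← Finset.mul_sum] at key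
  rw [Finset.mul_sum, Finset.mul_sum]
  convert key using 1
  · refine Finset.sum_congr rfl fun u hu => ?_
    rw [sum_subsetSum_erase hh, (Finset.mem_powersetCard.1 hu).2]
    push_cast; ring
  · refine Finset.sum_congr rfl fun u hu => ?_
    rw [sum_subsetSum_insert hg, (Finset.mem_powersetCard.1 hu).2]
    ring

/-- Below level `s` the second factor vanishes. From level `s` on, the coefficient `k + 1 - r` of
the recurrence is nonzero because `r < s`, so the zero propagates upwards. -/
theorem sum_subsetSum_mul_of_lt {r s : ℕ} {h g : Finset α → ℂ} (hh : IsHarmonic r h)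
    (hg : IsHarmonic s g) (hrs : r < s) (i : ℕ) :
    ∑ u ∈ Finset.univ.powersetCard i, subsetSum h u * subsetSum g u = 0 := by
  induction i with
  | zero =>
    refine Finset.sum_eq_zero fun u hu => ?_
    rw [subsetSum_eq_zero_of_card_lt hg, mul_zero]
    rw [(Finset.mem_powersetCard.1 hu).2]; omega
  | succ k ih =>
    by_cases hk : k + 1 < s
    · refine Finset.sum_eq_zero fun u hu => ?_
      rw [subsetSum_eq_zero_of_card_lt hg, mul_zero]
      rwa [(Finset.mem_powersetCard.1 hu).2]
    · have key := sum_subsetSum_mul_succ hh hg k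
      rw [ih, mul_zero] at key
      refine (mul_eq_zero.1 key).resolve_left ?_
      rw [← ne_eq, sub_ne_zero]
      exact_mod_cast (by omega : k + 1 ≠ r)

theorem sum_subsetSum_mul_of_ne {r s : ℕ} {h g : Finset α → ℂ} (hh : IsHarmonic r h)
    (hg : IsHarmonic s g) (hrs : r ≠ s) (i : ℕ) :
    ∑ u ∈ Finset.univ.powersetCard i, subsetSum h u * subsetSum g u = 0 := by
  rcases hrs.lt_or_gt with hlt | hlt
  · exact sum_subsetSum_mul_of_lt hh hg hlt i
  · simpa only [mul_comm] using sum_subsetSum_mul_of_lt hg hh hlt i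

/-- At equal `r` the ratio of consecutive levels is `(n - 2r - j) / (j + 1)`, which is the ratio of
consecutive binomial coefficients of `n - 2r`. -/
theorem sum_subsetSum_mul {r : ℕ} {h g : Finset α → ℂ} (hh : IsHarmonic r h)
    (hg : IsHarmonic r g) (j : ℕ) (hj : j + 2 * r ≤ Fintype.card α) :
    ∑ u ∈ Finset.univ.powersetCard (r + j), subsetSum h u * subsetSum g u =
      ((Fintype.card α - 2 * r).choose j : ℂ) * ∑ v, h v * g v := by
  induction j with
  | zero =>
    rw [add_zero, Nat.choose_zero_right, Nat.cast_one, one_mul,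
      ← Finset.sum_subset (Finset.subset_univ (Finset.univ.powersetCard r))]
    · refine Finset.sum_congr rfl fun u hu => ?_
      have := (Finset.mem_powersetCard.1 hu).2
      rw [subsetSum_of_card_eq hh this, subsetSum_of_card_eq hg this]
    · intro v _ hv
      rw [hh.support v (by simpa using hv), zero_mul]
  | succ j ih =>
    have key := sum_subsetSum_mul_succ hh hg (r + j)
    rw [ih (by omega)] at key
    have hc := congrArg (Nat.cast : ℕ → ℂ)
      (Nat.choose_succ_right_eq (Fintype.card α - 2 * r) j)
    rw [Nat.cast_mul, Nat.cast_mul, Nat.cast_sub (by omega), Nat.cast_sub (by omega)] at hc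
    push_cast at hc key
    have hne : (j : ℂ) + 1 ≠ 0 := by exact_mod_cast Nat.succ_ne_zero j
    refine mul_left_cancel₀ hne ?_
    rw [← add_assoc]
    linear_combination key - (∑ v, h v * g v) * hc

end Harmonic

/-! ### Vertices of the folded cube and their representatives -/

namespace FoldedVertex

variable {n : ℕ}

/-- The vertex `{u, uᶜ}`. -/
def ofSet (u : Finset (Fin n)) : FoldedVertex n := ⟨{u, uᶜ}, u, rfl⟩

theorem mem_ofSet {u w : Finset (Fin n)} : w ∈ (ofSet u).1 ↔ w = u ∨ w = uᶜ := by
  simp [ofSet]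

theorem ofSet_surjective : Function.Surjective (ofSet (n := n)) := by
  rintro ⟨p, u, rfl⟩
  exact ⟨u, rfl⟩

theorem ofSet_compl (u : Finset (Fin n)) : ofSet uᶜ = ofSet u := by
  refine Subtype.ext (Finset.ext fun w => ?_)
  rw [mem_ofSet, mem_ofSet, compl_compl, or_comm]

theorem ofSet_eq_ofSet_iff {u v : Finset (Fin n)} : ofSet u = ofSet v ↔ u = v ∨ u = vᶜ := by
  constructor
  · intro h
    exact mem_ofSet.1 (h ▸ mem_ofSet.2 (Or.inl rfl))
  · rintro (rfl | rfl)
    · rfl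
    · exact ofSet_compl v

theorem zero_eq : zero n = ofSet ∅ := rfl

theorem card_symmDiff_compl (u v : Finset (Fin n)) :
    (symmDiff u vᶜ).card = n - (symmDiff u v).card := by
  have : symmDiff u vᶜ = (symmDiff u v)ᶜ := by
    ext a
    simp only [Finset.mem_symmDiff, Finset.mem_compl]
    tauto
  rw [this, Finset.card_compl, Fintype.card_fin]

theorem sep_ofSet (u v : Finset (Fin n)) :
    sep (ofSet u) (ofSet v) = min (symmDiff u v).card (n - (symmDiff u v).card) := by
  have hset : {m | ∃ u' ∈ (ofSet u).1, ∃ v' ∈ (ofSet v).1, m = (symmDiff u' v').card} =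
      {(symmDiff u v).card, n - (symmDiff u v).card} := by
    have h1 := card_symmDiff_compl u v
    have h2 : (symmDiff uᶜ v).card = n - (symmDiff u v).card := by
      rw [symmDiff_comm, card_symmDiff_compl, symmDiff_comm]
    have h3 : (symmDiff uᶜ vᶜ).card = (symmDiff u v).card := by rw [compl_symmDiff_compl]
    ext m
    simp only [mem_ofSet, Set.mem_ofPred_eq, Set.mem_insert_iff, Set.mem_singleton_iff,
      exists_eq_or_imp, exists_eq_left, h1, h2, h3]
    tauto
  rw [sep, hset, csInf_pair]

theorem sep_zero_ofSet (u : Finset (Fin n)) :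
    sep (zero n) (ofSet u) = min u.card (n - u.card) := by
  rw [zero_eq, sep_ofSet, ← Finset.bot_eq_empty, bot_symmDiff]

theorem exists_ofSet_eq (x : FoldedVertex n) :
    ∃ u, ofSet u = x ∧ u.card = sep (zero n) x := by
  obtain ⟨u, rfl⟩ := ofSet_surjective x
  rw [sep_zero_ofSet]
  rcases le_total u.card (n - u.card) with h | h
  · exact ⟨u, rfl, by omega⟩
  · exact ⟨uᶜ, ofSet_compl u, by rw [Finset.card_compl, Fintype.card_fin]; omega⟩

theorem exists_ofSet_eq_sep (u : Finset (Fin n)) (y : FoldedVertex n) :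
    ∃ v, ofSet v = y ∧ (symmDiff u v).card = sep (ofSet u) y := by
  obtain ⟨v, rfl⟩ := ofSet_surjective y
  rw [sep_ofSet]
  rcases le_total (symmDiff u v).card (n - (symmDiff u v).card) with h | h
  · exact ⟨v, rfl, by omega⟩
  · exact ⟨vᶜ, ofSet_compl v, by rw [card_symmDiff_compl]; omega⟩

theorem sum_comp_ofSet {M : Type*} [AddCommMonoid M] (hn : 0 < n) (f : FoldedVertex n → M) :
    ∑ u, f (ofSet u) = 2 • ∑ x, f x := by
  have : NeZero n := ⟨hn.ne'⟩
  rw [← Finset.sum_fiberwise (s := Finset.univ) (g := ofSet), ← Finset.sum_nsmul]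
  refine Finset.sum_congr rfl fun x _ => ?_
  obtain ⟨u, rfl⟩ := ofSet_surjective x
  have hfib : Finset.univ.filter (fun w => ofSet w = ofSet u) = {u, uᶜ} := by
    ext w
    simp [ofSet_eq_ofSet_iff]
  have hne : u ≠ uᶜ := fun h => by
    have := congrArg (0 ∈ ·) h
    simp at this
  rw [hfib, Finset.sum_pair hne, ofSet_compl, two_nsmul]

/-- The sides of a vertex at distance `i` have the distinct sizes `i` and `n - i`, so the `i`-sets
meet each such vertex once. -/
theorem sum_ofSet_powersetCard_of_lt {f : FoldedVertex n → ℂ} {i : ℕ} (hi : 2 * i < n)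
    (hf : ∀ x, sep (zero n) x ≠ i → f x = 0) :
    ∑ u ∈ Finset.univ.powersetCard i, f (ofSet u) = ∑ x, f x := by
  have h1 := sum_comp_ofSet (by omega) f
  have h2 : ∑ u ∈ Finset.univ.powersetCard (n - i), f (ofSet u) =
      ∑ u ∈ Finset.univ.powersetCard i, f (ofSet u) := by
    refine Finset.sum_bij' (fun u _ => uᶜ) (fun u _ => uᶜ) ?_ ?_ ?_ ?_ ?_ <;>
    · intro u hu
      have := (Finset.mem_powersetCard.1 hu).2
      simp [Finset.mem_powersetCard, Finset.card_compl, ofSet_compl, this]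
      try omega
  have h3 : ∑ u, f (ofSet u) = ∑ u ∈ Finset.univ.powersetCard i, f (ofSet u) +
      ∑ u ∈ Finset.univ.powersetCard (n - i), f (ofSet u) := by
    rw [← Finset.sum_union]
    · symm
      refine Finset.sum_subset (Finset.subset_univ _) fun u _ hu => hf _ ?_
      rw [sep_zero_ofSet]
      simp only [Finset.mem_union, Finset.mem_powersetCard, Finset.subset_univ, true_and] at hu
      have := Finset.card_le_univ u
      rw [Fintype.card_fin] at this
      omega
    · rw [Finset.disjoint_left]
      intro u h h'
      have := (Finset.mem_powersetCard.1 h).2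
      have := (Finset.mem_powersetCard.1 h').2
      omega
  rw [h3, h2, two_nsmul] at h1
  linear_combination h1 / 2

theorem sum_ofSet_powersetCard_of_eq {f : FoldedVertex n → ℂ} {i : ℕ} (hi : 2 * i = n)
    (hn : 0 < n) (hf : ∀ x, sep (zero n) x ≠ i → f x = 0) :
    ∑ u ∈ Finset.univ.powersetCard i, f (ofSet u) = 2 * ∑ x, f x := by
  have h1 := sum_comp_ofSet hn f
  rw [nsmul_eq_mul, Nat.cast_ofNat] at h1
  rw [← h1]
  refine Finset.sum_subset (Finset.subset_univ _) fun u _ hu => hf _ ?_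
  rw [sep_zero_ofSet]
  simp only [Finset.mem_powersetCard, Finset.subset_univ, true_and] at hu
  omega

end FoldedVertex

/-! ### Distance in the folded cube -/

section Distance

open FoldedVertex

variable {n : ℕ}

theorem symmDiff_singleton_of_mem {u : Finset (Fin n)} {a : Fin n} (ha : a ∈ u) :
    symmDiff u {a} = u.erase a := by
  ext b
  simp only [Finset.mem_symmDiff, Finset.mem_singleton, Finset.mem_erase]
  constructor
  · rintro (h | ⟨rfl, h⟩)
    · exact ⟨h.2, h.1⟩
    · exact absurd ha h
  · exact fun h => Or.inl ⟨h.2, h.1⟩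

theorem symmDiff_singleton_of_notMem {u : Finset (Fin n)} {a : Fin n} (ha : a ∉ u) :
    symmDiff u {a} = insert a u := by
  ext b
  simp only [Finset.mem_symmDiff, Finset.mem_singleton, Finset.mem_insert]
  constructor
  · rintro (h | h)
    · exact Or.inr h.1
    · exact Or.inl h.1
  · rintro (rfl | h)
    · exact Or.inr ⟨rfl, ha⟩
    · exact Or.inl ⟨h, fun hb => ha (hb ▸ h)⟩

theorem sum_symmDiff_singleton {M : Type*} [AddCommMonoid M] (F : Finset (Fin n) → M)
    (u : Finset (Fin n)) :
    ∑ a, F (symmDiff u {a}) = ∑ a ∈ u, F (u.erase a) + ∑ a ∈ uᶜ, F (insert a u) := by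
  rw [← Finset.sum_add_sum_compl u]
  congr 1
  · exact Finset.sum_congr rfl fun a ha => by rw [symmDiff_singleton_of_mem ha]
  · exact Finset.sum_congr rfl fun a ha => by
      rw [symmDiff_singleton_of_notMem (Finset.mem_compl.1 ha)]

theorem foldedCube_adj_ofSet_iff (hn : 3 ≤ n) (u : Finset (Fin n)) (y : FoldedVertex n) :
    (foldedCube n).Adj (ofSet u) y ↔ ∃ a, ofSet (symmDiff u {a}) = y := by
  change sep (ofSet u) y = 1 ↔ _
  constructor
  · intro h
    obtain ⟨v, rfl, hv⟩ := exists_ofSet_eq_sep u y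
    rw [h] at hv
    obtain ⟨a, ha⟩ := Finset.card_eq_one.1 hv
    exact ⟨a, by rw [← ha, symmDiff_symmDiff_cancel_left]⟩
  · rintro ⟨a, rfl⟩
    rw [sep_ofSet, symmDiff_symmDiff_cancel_left, Finset.card_singleton]
    omega

/-- Two different flips of `u` could only coincide as complements, which forces `{a} = {b}ᶜ` and so
`n = 2`. -/
theorem ofSet_symmDiff_singleton_injective (hn : 3 ≤ n) (u : Finset (Fin n)) :
    Function.Injective fun a : Fin n => ofSet (symmDiff u {a}) := by
  intro a b hab
  rcases ofSet_eq_ofSet_iff.1 hab with h | h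
  · exact Finset.singleton_injective (symmDiff_right_injective u h)
  · exfalso
    have h1 : ({a} : Finset (Fin n)) = {b}ᶜ := by
      have h2 : (symmDiff u {b})ᶜ = symmDiff u {b}ᶜ := by
        ext c
        simp only [Finset.mem_symmDiff, Finset.mem_compl]
        tauto
      rw [h2] at h
      exact symmDiff_right_injective u h
    have h3 := congrArg Finset.card h1
    rw [Finset.card_compl, Fintype.card_fin, Finset.card_singleton, Finset.card_singleton] at h3
    omega

theorem exists_walk_length_eq (hn : 3 ≤ n) (k : ℕ) (u v : Finset (Fin n))
    (hk : (symmDiff u v).card = k) :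
    ∃ p : (foldedCube n).Walk (ofSet u) (ofSet v), p.length = k := by
  induction k generalizing u with
  | zero =>
    rw [Finset.card_eq_zero, ← Finset.bot_eq_empty, symmDiff_eq_bot] at hk
    subst hk
    exact ⟨.nil, rfl⟩
  | succ k ih =>
    obtain ⟨a, ha⟩ := Finset.card_pos.1 (by omega : 0 < (symmDiff u v).card)
    have h1 : symmDiff (symmDiff u {a}) v = (symmDiff u v).erase a := by
      rw [symmDiff_right_comm, symmDiff_singleton_of_mem ha]
    obtain ⟨p, hp⟩ := ih (symmDiff u {a}) (by rw [h1, Finset.card_erase_of_mem ha]; omega)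
    exact ⟨.cons ((foldedCube_adj_ofSet_iff hn u _).2 ⟨a, rfl⟩) p, by simp [hp]⟩

/-- A walk lifts to the unfolded cube from any side of its starting vertex, each edge flipping one
point. -/
theorem exists_ofSet_card_symmDiff_le (hn : 3 ≤ n) {x y : FoldedVertex n}
    (p : (foldedCube n).Walk x y) :
    ∀ u, ofSet u = x → ∃ v, ofSet v = y ∧ (symmDiff u v).card ≤ p.length := by
  induction p with
  | nil => exact fun u hu => ⟨u, hu, by simp⟩
  | cons h p ih =>
    rintro u rfl
    obtain ⟨a, ha⟩ := (foldedCube_adj_ofSet_iff hn u _).1 h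
    obtain ⟨v, hv, hle⟩ := ih _ ha
    refine ⟨v, hv, ?_⟩
    have h1 : symmDiff u v ⊆ {a} ∪ symmDiff (symmDiff u {a}) v := by
      intro c
      simp only [Finset.mem_symmDiff, Finset.mem_union, Finset.mem_singleton]
      tauto
    have h2 := (Finset.card_le_card h1).trans (Finset.card_union_le _ _)
    rw [Finset.card_singleton] at h2
    rw [SimpleGraph.Walk.length_cons]
    omega

theorem foldedCube_dist (hn : 3 ≤ n) (x y : FoldedVertex n) :
    (foldedCube n).dist x y = sep x y := by
  obtain ⟨u, rfl⟩ := ofSet_surjective x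
  obtain ⟨v, rfl, hv⟩ := exists_ofSet_eq_sep u y
  obtain ⟨p, hp⟩ := exists_walk_length_eq hn _ u v hv
  refine le_antisymm (hp ▸ SimpleGraph.dist_le p) ?_
  obtain ⟨q, hq⟩ := p.reachable.exists_walk_length_eq_dist
  obtain ⟨w, hw, hle⟩ := exists_ofSet_card_symmDiff_le hn q u rfl
  calc sep (ofSet u) (ofSet v) = sep (ofSet u) (ofSet w) := by rw [hw]
    _ ≤ (symmDiff u w).card := by rw [sep_ofSet]; exact min_le_left _ _
    _ ≤ _ := hq ▸ hle

theorem distMatrix_apply (hn : 3 ≤ n) (i : ℕ) (x y : FoldedVertex n) :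
    distMatrix (foldedCube n) i x y = if sep x y = i then 1 else 0 := by
  simp [distMatrix, foldedCube_dist hn]

theorem distMatrix_one_mulVec (hn : 3 ≤ n) (g : FoldedVertex n → ℂ) (u : Finset (Fin n)) :
    (distMatrix (foldedCube n) 1 *ᵥ g) (ofSet u) = ∑ a, g (ofSet (symmDiff u {a})) := by
  rw [← Finset.sum_image (f := g) (s := Finset.univ) (g := fun a => ofSet (symmDiff u {a}))
    (ofSet_symmDiff_singleton_injective hn u).injOn]
  have : Finset.univ.image (fun a => ofSet (symmDiff u {a})) =
      Finset.univ.filter fun y => sep (ofSet u) y = 1 := by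
    ext y
    simp only [Finset.mem_image, Finset.mem_univ, true_and, Finset.mem_filter]
    exact (foldedCube_adj_ofSet_iff hn u y).symm
  rw [this, Finset.sum_filter, Matrix.mulVec, dotProduct]
  simp [distMatrix_apply hn]

theorem distMatrix_zero (hn : 3 ≤ n) : distMatrix (foldedCube n) 0 = 1 := by
  ext x y
  rw [distMatrix_apply hn, Matrix.one_apply]
  congr 1
  rw [← foldedCube_dist hn]
  obtain ⟨u, rfl⟩ := ofSet_surjective x
  obtain ⟨v, rfl⟩ := ofSet_surjective y
  obtain ⟨p, -⟩ := exists_walk_length_eq hn _ u v rfl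
  rw [p.reachable.dist_eq_zero_iff]

theorem distMatrix_eq_zero {D i : ℕ} (hD : 2 ≤ D) (hi : D < i) :
    distMatrix (foldedCube (2 * D)) i = 0 := by
  ext x y
  obtain ⟨u, rfl⟩ := ofSet_surjective x
  obtain ⟨v, rfl⟩ := ofSet_surjective y
  rw [distMatrix_apply (by omega), sep_ofSet, Matrix.zero_apply, if_neg (by omega)]

/-- The entry counts the points whose flip takes `w = u ∆ v` to folded level `i`. From `|w| = i + 1`
these are the points of `w`, except that from `|w| = D` every flip leads to level `D - 1`, whence
the coefficient `2 * D`. From `|w| = i - 1` they are the points outside `w`. -/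
theorem distMatrix_one_mul {D i : ℕ} (hD : 2 ≤ D) (hi : i < D) :
    distMatrix (foldedCube (2 * D)) 1 * distMatrix (foldedCube (2 * D)) i =
      (if i + 1 = D then 2 * D else i + 1 : ℂ) • distMatrix (foldedCube (2 * D)) (i + 1) +
      (if i = 0 then 0 else (2 * D - i + 1 : ℂ)) • distMatrix (foldedCube (2 * D)) (i - 1) := by
  ext x y
  obtain ⟨u, rfl⟩ := ofSet_surjective x
  obtain ⟨v, rfl, hv⟩ := exists_ofSet_eq_sep u y
  have hle : sep (ofSet u) (ofSet v) ≤ D := by rw [sep_ofSet]; omega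
  have hn : 3 ≤ 2 * D := by omega
  have h1 : (distMatrix (foldedCube (2 * D)) 1 * distMatrix (foldedCube (2 * D)) i)
      (ofSet u) (ofSet v) = ∑ a, distMatrix (foldedCube (2 * D)) i
        (ofSet (symmDiff u {a})) (ofSet v) :=
    distMatrix_one_mulVec hn (fun x => distMatrix (foldedCube (2 * D)) i x (ofSet v)) u
  have h2 : ∀ a, distMatrix (foldedCube (2 * D)) i (ofSet (symmDiff u {a})) (ofSet v) =
      if min (symmDiff (symmDiff u v) {a}).card (2 * D - (symmDiff (symmDiff u v) {a}).card) = i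
        then 1 else 0 := by
    intro a
    rw [distMatrix_apply hn, sep_ofSet, symmDiff_right_comm]
  rw [h1, Finset.sum_congr rfl fun a _ => h2 a,
    sum_symmDiff_singleton (fun w => if min w.card (2 * D - w.card) = i then (1 : ℂ) else 0)]
  rw [Matrix.add_apply, Matrix.smul_apply, Matrix.smul_apply, distMatrix_apply hn,
    distMatrix_apply hn, ← hv]
  rw [← hv] at hle
  set w := symmDiff u v
  have h3 : ∑ a ∈ w, (if min (w.erase a).card (2 * D - (w.erase a).card) = i then (1 : ℂ) else 0)
      = if w.card = i + 1 then (w.card : ℂ) else 0 := by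
    have : ∀ a ∈ w, (if min (w.erase a).card (2 * D - (w.erase a).card) = i then (1 : ℂ) else 0) =
        if w.card = i + 1 then 1 else 0 := by
      intro a ha
      have := Finset.card_pos.2 ⟨a, ha⟩
      rw [Finset.card_erase_of_mem ha]
      congr 1
      apply propext
      omega
    rw [Finset.sum_congr rfl this]
    simp
  have h4 : ∑ a ∈ wᶜ, (if min (insert a w).card (2 * D - (insert a w).card) = i
      then (1 : ℂ) else 0) =
      if min (w.card + 1) (2 * D - (w.card + 1)) = i then (2 * D - w.card : ℂ) else 0 := by
    have : ∀ a ∈ wᶜ, (if min (insert a w).card (2 * D - (insert a w).card) = i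
      then (1 : ℂ) else 0) = if min (w.card + 1) (2 * D - (w.card + 1)) = i then 1 else 0 := by
      intro a ha
      rw [Finset.card_insert_of_notMem (Finset.mem_compl.1 ha)]
    rw [Finset.sum_congr rfl this]
    simp [Finset.card_compl, Nat.cast_sub (show w.card ≤ 2 * D by omega)]
  rw [h3, h4]
  have hcases : w.card = i + 1 ∨ w.card + 1 = i ∨ (w.card ≠ i + 1 ∧ w.card + 1 ≠ i) := by omega
  rcases hcases with h | h | ⟨h, h'⟩
  · rw [if_pos h, if_pos h, if_neg (show ¬ w.card = i - 1 by omega), h]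
    by_cases hiD : i + 1 = D
    · rw [if_pos (by omega), if_pos hiD]
      push_cast
      simp only [smul_eq_mul]
      ring
    · rw [if_neg (by omega), if_neg hiD]
      simp
  · rw [if_neg (show ¬ w.card = i + 1 by omega), if_pos (by omega),
      if_neg (show ¬ w.card = i + 1 by omega), if_neg (show ¬ i = 0 by omega),
      if_pos (show w.card = i - 1 by omega)]
    have : (w.card : ℂ) + 1 = i := by exact_mod_cast h
    simp only [smul_eq_mul]
    linear_combination -this
  · rw [if_neg h, if_neg (by omega), if_neg h]
    by_cases hi0 : i = 0
    · simp [hi0]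
    · rw [if_neg (show ¬ w.card = i - 1 by omega)]
      simp

/-- The leading coefficient of the three-term recurrence is nonzero, so it can be solved for the
next distance matrix up to `D`. -/
theorem distMatrix_mem_adjoin {D : ℕ} (hD : 2 ≤ D) (i : ℕ) :
    distMatrix (foldedCube (2 * D)) i ∈ Algebra.adjoin ℂ {distMatrix (foldedCube (2 * D)) 1} := by
  have h1 := Algebra.self_mem_adjoin_singleton ℂ (distMatrix (foldedCube (2 * D)) 1)
  induction i using Nat.strong_induction_on with
  | _ i ih =>
    rcases i with _ | i
    · rw [distMatrix_zero (by omega)]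
      exact one_mem _
    · by_cases hi : i < D
      · have key := distMatrix_one_mul hD hi
        have hc : (if i + 1 = D then 2 * D else i + 1 : ℂ) ≠ 0 := by
          split_ifs
          · simp; omega
          · exact_mod_cast i.succ_ne_zero
        rw [← sub_eq_iff_eq_add] at key
        rw [← inv_smul_smul₀ hc (distMatrix (foldedCube (2 * D)) (i + 1)), ← key]
        exact Subalgebra.smul_mem _ (sub_mem (mul_mem h1 (ih i (by omega)))
          (Subalgebra.smul_mem _ (ih (i - 1) (by omega)) _)) _
      · rw [distMatrix_eq_zero hD (show D < i + 1 by omega)]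
        exact zero_mem _

end Distance

/-! ### The columns of `U₂` as subset sums of harmonic functions -/

section Columns

open FoldedVertex

variable {D : ℕ}

/-- The function on sets of size `r` attached to a vector on the vertices of the folded cube. -/
noncomputable def levelLift (D r : ℕ) (ξ : FoldedVertex (2 * D) → ℂ) (v : Finset (Fin (2 * D))) :
    ℂ :=
  if v.card = r then ξ (ofSet v) else 0

/-- The number of representatives of size `i` of a vertex at distance `i` from `{∅, S}`. -/
noncomputable def levelWeight (D i : ℕ) : ℂ := if i = D then 2 else 1

theorem levelWeight_ne_zero (D i : ℕ) : levelWeight D i ≠ 0 := by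
  unfold levelWeight
  split_ifs <;> norm_num

theorem sep_zero_le (x : FoldedVertex (2 * D)) : sep (zero (2 * D)) x ≤ D := by
  obtain ⟨u, rfl⟩ := ofSet_surjective x
  rw [sep_zero_ofSet]
  omega

theorem sum_ofSet_powersetCard {f : FoldedVertex (2 * D) → ℂ} {i : ℕ} (hD : 0 < D) (hi : i ≤ D)
    (hf : ∀ x, sep (zero (2 * D)) x ≠ i → f x = 0) :
    ∑ u ∈ Finset.univ.powersetCard i, f (ofSet u) = levelWeight D i * ∑ x, f x := by
  unfold levelWeight
  split_ifs with h
  · exact sum_ofSet_powersetCard_of_eq (by omega) (by omega) hf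
  · rw [one_mul]
    exact sum_ofSet_powersetCard_of_lt (by omega) hf

/-- Since `t = min i r` is an upper bound for every intersection, maximality is automatic and only
attainment matters. The side `v` is unique as `r < D`; the side `uᶜ` also qualifies exactly when `i
= D`. -/
theorem tripleRel_ofSet {i r t : ℕ} {u v : Finset (Fin (2 * D))} (hu : u.card = i) (hi : i ≤ D)
    (hv : v.card = r) (hr : r < D) (ht : t = min i r) :
    tripleRel D i r t (ofSet u) (ofSet v) ↔
      (u ∩ v).card = t ∨ (i = D ∧ (uᶜ ∩ v).card = t) := by
  have huc : uᶜ.card = 2 * D - i := by rw [Finset.card_compl, Fintype.card_fin, hu]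
  have hvc : vᶜ.card = 2 * D - r := by rw [Finset.card_compl, Fintype.card_fin, hv]
  have h1 : sep (zero (2 * D)) (ofSet u) = i := by rw [sep_zero_ofSet]; omega
  have h2 : sep (zero (2 * D)) (ofSet v) = r := by rw [sep_zero_ofSet]; omega
  rw [tripleRel, h1, h2]
  simp only [true_and, IsGreatest]
  rw [and_iff_left]
  · simp only [mem_ofSet, Set.mem_ofPred_eq, exists_eq_or_imp, exists_eq_left, hu, hv, huc, hvc]
    constructor
    · rintro ((⟨-, -, h⟩ | ⟨-, h, -⟩) | (⟨h, -, h'⟩ | ⟨-, h, -⟩))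
      · exact Or.inl h.symm
      · omega
      · exact Or.inr ⟨by omega, h'.symm⟩
      · omega
    · rintro (h | ⟨h, h'⟩)
      · exact Or.inl (Or.inl ⟨trivial, trivial, h.symm⟩)
      · exact Or.inr (Or.inl ⟨by omega, trivial, h'.symm⟩)
  · rintro m ⟨u', -, v', -, hu', hv', rfl⟩
    rw [ht, ← hu', ← hv']
    exact le_min (Finset.card_le_card Finset.inter_subset_left)
      (Finset.card_le_card Finset.inter_subset_right)

theorem orbitMatrix_mulVec_ofSet {i r t : ℕ} {u : Finset (Fin (2 * D))} (hu : u.card = i)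
    (hi : i ≤ D) (hr : r < D) (ht : t = min i r) (ξ : FoldedVertex (2 * D) → ℂ) :
    (orbitMatrix D i r t *ᵥ ξ) (ofSet u) =
      ∑ v, if (u ∩ v).card = t ∨ (i = D ∧ (uᶜ ∩ v).card = t) then levelLift D r ξ v else 0 := by
  classical
  have h1 := sum_ofSet_powersetCard (by omega) hr.le (i := r)
    (f := fun y => orbitMatrix D i r t (ofSet u) y * ξ y) (fun y hy => by
      rw [orbitMatrix, Matrix.of_apply, if_neg fun h => hy h.2.1, zero_mul])
  rw [levelWeight, if_neg hr.ne, one_mul] at h1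
  rw [Matrix.mulVec, dotProduct, ← h1]
  rw [← Finset.sum_subset (Finset.subset_univ (Finset.univ.powersetCard r))]
  · refine Finset.sum_congr rfl fun v hv => ?_
    have hv := (Finset.mem_powersetCard.1 hv).2
    simp only [orbitMatrix, Matrix.of_apply, tripleRel_ofSet hu hi hv hr ht, levelLift, if_pos hv,
      ite_mul, one_mul, zero_mul]
  · intro v _ hv
    rw [levelLift, if_neg (show ¬ v.card = r by simpa using hv), ite_self]

theorem isHarmonic_levelLift {r : ℕ} (hr : r < D) {ξ : EuclideanSpace ℂ (FoldedVertex (2 * D))}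
    (hξ : ξ ∈ lowestSpace D r) : IsHarmonic r (levelLift D r ξ.ofLp) := by
  refine ⟨fun v hv => if_neg hv, fun w hw => ?_⟩
  have h1 := congrFun (hξ.1 w.card hw) (ofSet w)
  rw [orbitMatrix_mulVec_ofSet rfl (by omega) hr (by omega), Pi.zero_apply] at h1
  refine Eq.trans ?_ h1
  refine Finset.sum_congr rfl fun v _ => if_congr ?_ rfl rfl
  rw [or_iff_left (fun h => by omega)]
  constructor
  · intro h
    rw [Finset.inter_eq_left.2 h]
  · intro h
    exact Finset.inter_eq_left.1 (Finset.eq_of_subset_of_card_le Finset.inter_subset_left h.ge)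

theorem sum_levelLift_star_mul {r : ℕ} (hr : r < D) {ξ η : EuclideanSpace ℂ (FoldedVertex (2 * D))}
    (hξ : ξ ∈ lowestSpace D r) :
    ∑ v, star (levelLift D r ξ.ofLp) v * levelLift D r η.ofLp v = inner ℂ ξ η := by
  have h1 := sum_ofSet_powersetCard (by omega) hr.le (i := r)
    (f := fun y => star (ξ y) * η y) (fun y hy => by rw [hξ.2 y hy, star_zero, zero_mul])
  rw [levelWeight, if_neg hr.ne, one_mul] at h1
  rw [PiLp.inner_apply]
  simp only [RCLike.inner_apply']
  rw [← Finset.sum_subset (Finset.subset_univ (Finset.univ.powersetCard r))]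
  · refine Eq.trans ?_ h1
    refine Finset.sum_congr rfl fun v hv => ?_
    have hv := (Finset.mem_powersetCard.1 hv).2
    simp [levelLift, hv]
  · intro v _ hv
    simp [levelLift, if_neg (show ¬ v.card = r by simpa using hv)]

/-- The factor between a column of `U₂` and the subset sums of the harmonic function. -/
noncomputable def columnFactor (D r i : ℕ) : ℝ :=
  (if i = D then √2 else 1) * (√((2 * D - 2 * r).choose (i - r) : ℝ))⁻¹

theorem columnFactor_pos {r i : ℕ} (hr : r < D) (hi : i ≤ D) : 0 < columnFactor D r i := by
  have : 0 < (2 * D - 2 * r).choose (i - r) := Nat.choose_pos (by omega)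
  unfold columnFactor
  split_ifs <;> positivity

/-- Normalization: the binomial is the norm factor of `sum_subsetSum_mul`, and the weight remains
because summing over sets counts each vertex of level `D` twice. -/
theorem columnFactor_mul_self {r i : ℕ} (hr : r < D) (hi : i ≤ D) :
    (columnFactor D r i : ℂ) * columnFactor D r i * ((2 * D - 2 * r).choose (i - r) : ℂ) =
      levelWeight D i := by
  have hpos : 0 < (2 * D - 2 * r).choose (i - r) := Nat.choose_pos (by omega)
  have h2 : columnFactor D r i * columnFactor D r i * ((2 * D - 2 * r).choose (i - r) : ℝ) =
      if i = D then 2 else 1 := by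
    have hc : (0 : ℝ) < (2 * D - 2 * r).choose (i - r) := by exact_mod_cast hpos
    have hs := Real.mul_self_sqrt hc.le
    have hs0 := (Real.sqrt_pos.2 hc).ne'
    unfold columnFactor
    generalize √((2 * D - 2 * r).choose (i - r) : ℝ) = s at *
    rw [← hs]
    have h22 := Real.mul_self_sqrt (show (0 : ℝ) ≤ 2 by norm_num)
    split_ifs
    · field_simp
      linear_combination h22
    · field_simp
  rw [levelWeight]
  have h3 := congrArg (Complex.ofReal) h2
  push_cast at h3
  rw [h3]
  split_ifs <;> simp

theorem orbitMatrix_mulVec_apply_of_ne {i r t : ℕ} {x : FoldedVertex (2 * D)}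
    (hx : sep (zero (2 * D)) x ≠ i) (ξ : FoldedVertex (2 * D) → ℂ) :
    (orbitMatrix D i r t *ᵥ ξ) x = 0 := by
  classical
  rw [Matrix.mulVec, dotProduct]
  refine Finset.sum_eq_zero fun y _ => ?_
  rw [orbitMatrix, Matrix.of_apply, if_neg fun h => hx h.1, zero_mul]

theorem subset_iff_card_inter_eq {α : Type*} [DecidableEq α] {u v : Finset α} :
    (u ∩ v).card = v.card ↔ v ⊆ u := by
  constructor
  · intro h
    exact Finset.inter_eq_right.1 (Finset.eq_of_subset_of_card_le Finset.inter_subset_right h.ge)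
  · intro h
    rw [Finset.inter_eq_right.2 h]

/-- At level `D` the matrix collects the `r`-sets inside `u` or inside `uᶜ`. For even `r > 0` these
families are disjoint and give equal sums, turning `√2 / 2` into `√2`; for `r = 0` the empty set
lies in both and is counted once, hence the separate normalization. -/
theorem normFactor_mul_orbitMatrix_mulVec {r i : ℕ} (hr : r < D) (hri : r ≤ i) (hi : i ≤ D)
    (hpar : i = D → Even r) {ξ : EuclideanSpace ℂ (FoldedVertex (2 * D))}
    (hξ : ξ ∈ lowestSpace D r) {u : Finset (Fin (2 * D))} (hu : u.card = i) :
    (normFactor D r i : ℂ) * (orbitMatrix D i r r *ᵥ ξ.ofLp) (ofSet u) =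
      columnFactor D r i * subsetSum (levelLift D r ξ.ofLp) u := by
  have hh := isHarmonic_levelLift hr hξ
  rw [orbitMatrix_mulVec_ofSet hu hi hr (by omega)]
  by_cases hiD : i = D
  · rcases Nat.eq_zero_or_pos r with rfl | hr0
    · have : ∀ v, (if (u ∩ v).card = 0 ∨ (i = D ∧ (uᶜ ∩ v).card = 0) then
          levelLift D 0 ξ.ofLp v else 0) = if v ⊆ u then levelLift D 0 ξ.ofLp v else 0 := by
        intro v
        by_cases hv : v.card = 0
        · rw [Finset.card_eq_zero] at hv
          simp [hv]
        · simp [hh.support v hv]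
      rw [Finset.sum_congr rfl fun v _ => this v, ← subsetSum]
      simp [normFactor, columnFactor, hiD]
    · have : ∀ v, (if (u ∩ v).card = r ∨ (i = D ∧ (uᶜ ∩ v).card = r) then
          levelLift D r ξ.ofLp v else 0) = (if v ⊆ u then levelLift D r ξ.ofLp v else 0) +
            if v ⊆ uᶜ then levelLift D r ξ.ofLp v else 0 := by
        intro v
        by_cases hv : v.card = r
        · simp only [← hv, subset_iff_card_inter_eq]
          by_cases h1 : v ⊆ u
          · have h2 : ¬ v ⊆ uᶜ := by
              intro h2
              obtain ⟨a, ha⟩ := Finset.card_pos.1 (by omega : 0 < v.card)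
              exact Finset.mem_compl.1 (h2 ha) (h1 ha)
            simp [h1, h2]
          · simp [h1, hiD]
        · simp [hh.support v hv]
      rw [Finset.sum_congr rfl fun v _ => this v, Finset.sum_add_distrib, ← subsetSum,
        ← subsetSum, subsetSum_compl hh, (hpar hiD).neg_one_pow]
      simp only [normFactor, columnFactor, if_neg hr0.ne', hiD]
      push_cast
      ring
  · have : ∀ v, (if (u ∩ v).card = r ∨ (i = D ∧ (uᶜ ∩ v).card = r) then
        levelLift D r ξ.ofLp v else 0) = if v ⊆ u then levelLift D r ξ.ofLp v else 0 := by
      intro v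
      by_cases hv : v.card = r
      · simp only [← hv, subset_iff_card_inter_eq]
        simp [hiD]
      · simp [hh.support v hv]
    rw [Finset.sum_congr rfl fun v _ => this v, ← subsetSum]
    simp [normFactor, columnFactor, hiD]

theorem blockIndex_bounds {r : Fin D} (i : BlockIndex D r) :
    (r : ℕ) ≤ i ∧ (i : ℕ) ≤ D ∧ ((i : ℕ) = D → Even (r : ℕ)) := by
  obtain ⟨i, hi⟩ := i
  rw [Finset.mem_Icc] at hi
  have := r.2
  refine ⟨hi.1, ?_, fun h => ?_⟩
  · split_ifs at hi <;> simp only <;> omega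
  · by_contra hodd
    rw [if_neg hodd] at hi
    simp only at h
    omega

variable {ι : Fin D → Type*} [∀ r, Fintype (ι r)]
  (b : ∀ r : Fin D, OrthonormalBasis (ι r) ℂ (lowestSpace D r))

/-- The harmonic function of a basis vector. -/
noncomputable def basisLift (r : Fin D) (ξ : ι r) : Finset (Fin (2 * D)) → ℂ :=
  levelLift D r (b r ξ : EuclideanSpace ℂ (FoldedVertex (2 * D))).ofLp

theorem isHarmonic_basisLift (r : Fin D) (ξ : ι r) : IsHarmonic r (basisLift b r ξ) :=
  isHarmonic_levelLift r.2 (b r ξ).2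

theorem basisMatrix_ofSet {r : Fin D} {ξ : ι r} {i : BlockIndex D r} {u : Finset (Fin (2 * D))}
    (hu : u.card = i) :
    basisMatrix D b (ofSet u) ⟨r, ξ, i⟩ = columnFactor D r i * subsetSum (basisLift b r ξ) u :=
  normFactor_mul_orbitMatrix_mulVec r.2 (blockIndex_bounds i).1 (blockIndex_bounds i).2.1
    (blockIndex_bounds i).2.2 (b r ξ).2 hu

theorem basisMatrix_apply_of_ne {r : Fin D} {ξ : ι r} {i : BlockIndex D r}
    {x : FoldedVertex (2 * D)} (hx : sep (zero (2 * D)) x ≠ i) :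
    basisMatrix D b x ⟨r, ξ, i⟩ = 0 := by
  rw [basisMatrix, Matrix.of_apply, orbitMatrix_mulVec_apply_of_ne hx, mul_zero]

theorem basisMatrix_ofSet_of_le {r : Fin D} {ξ : ι r} {i : BlockIndex D r}
    {u : Finset (Fin (2 * D))} (hu : u.card ≤ D) :
    basisMatrix D b (ofSet u) ⟨r, ξ, i⟩ =
      if u.card = i then columnFactor D r i * subsetSum (basisLift b r ξ) u else 0 := by
  by_cases h : u.card = i
  · rw [if_pos h]
    exact basisMatrix_ofSet b h
  · rw [if_neg h]
    refine basisMatrix_apply_of_ne b ?_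
    rw [sep_zero_ofSet]
    omega

theorem basisMatrix_ofSet_of_card_eq_add_one {r : Fin D} {ξ : ι r} {i : BlockIndex D r}
    {u : Finset (Fin (2 * D))} (hu : u.card = D + 1) :
    basisMatrix D b (ofSet u) ⟨r, ξ, i⟩ =
      if (i : ℕ) + 1 = D then
        columnFactor D r i * ((-1) ^ (r : ℕ) * subsetSum (basisLift b r ξ) u) else 0 := by
  have hc : uᶜ.card = D - 1 := by rw [Finset.card_compl, Fintype.card_fin]; omega
  have hr := r.2
  rw [← ofSet_compl, basisMatrix_ofSet_of_le b (by omega), hc,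
    subsetSum_compl (isHarmonic_basisLift b r ξ)]
  exact if_congr (by omega) rfl rfl

theorem sum_basisMatrix_erase {r : Fin D} {ξ : ι r} {i : BlockIndex D r}
    {u : Finset (Fin (2 * D))} (hu : u.card ≤ D) :
    ∑ a ∈ u, basisMatrix D b (ofSet (u.erase a)) ⟨r, ξ, i⟩ =
      if u.card = i + 1 then columnFactor D r i *
        (((u.card : ℂ) - (r : ℕ)) * subsetSum (basisLift b r ξ) u) else 0 := by
  rw [← sum_subsetSum_erase (isHarmonic_basisLift b r ξ)]
  have h : ∀ a ∈ u, basisMatrix D b (ofSet (u.erase a)) ⟨r, ξ, i⟩ =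
      if u.card = i + 1 then columnFactor D r i * subsetSum (basisLift b r ξ) (u.erase a)
        else 0 := by
    intro a ha
    have hpos := Finset.card_pos.2 ⟨a, ha⟩
    have hc := Finset.card_erase_of_mem ha
    rw [basisMatrix_ofSet_of_le b (by omega)]
    exact if_congr (by omega) rfl rfl
  rw [Finset.sum_congr rfl h]
  by_cases hc : u.card = i + 1
  · simp only [if_pos hc, Finset.mul_sum]
  · simp only [if_neg hc, Finset.sum_const_zero]

/-- If `|u| = D`, an insertion leaves the lower half and is folded back to level `D - 1`, which
costs the sign `(-1)^r`. -/
theorem sum_basisMatrix_insert {r : Fin D} {ξ : ι r} {i : BlockIndex D r}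
    {u : Finset (Fin (2 * D))} (hu : u.card ≤ D) :
    ∑ a ∈ uᶜ, basisMatrix D b (ofSet (insert a u)) ⟨r, ξ, i⟩ =
      (if u.card + 1 = i ∨ (u.card = D ∧ (i : ℕ) + 1 = D) then
        columnFactor D r i * ((if u.card = D then (-1) ^ (r : ℕ) else 1) *
          ((2 * D - (u.card : ℂ) - (r : ℕ)) * subsetSum (basisLift b r ξ) u)) else 0) := by
  have hs := sum_subsetSum_insert (isHarmonic_basisLift b r ξ) u
  rw [Fintype.card_fin, Nat.cast_mul, Nat.cast_ofNat] at hs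
  rw [← hs]
  have hb := blockIndex_bounds i
  have h : ∀ a ∈ uᶜ, basisMatrix D b (ofSet (insert a u)) ⟨r, ξ, i⟩ =
      if u.card + 1 = i ∨ (u.card = D ∧ (i : ℕ) + 1 = D) then
        columnFactor D r i * ((if u.card = D then (-1) ^ (r : ℕ) else 1) *
          subsetSum (basisLift b r ξ) (insert a u)) else 0 := by
    intro a ha
    have hc := Finset.card_insert_of_notMem (Finset.mem_compl.1 ha)
    by_cases huD : u.card = D
    · rw [basisMatrix_ofSet_of_card_eq_add_one b (by omega)]
      simp only [if_pos huD]
      exact if_congr (by omega) rfl rfl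
    · rw [basisMatrix_ofSet_of_le b (by omega)]
      simp only [if_neg huD, one_mul]
      exact if_congr (by omega) rfl rfl
  rw [Finset.sum_congr rfl h]
  by_cases hc : u.card + 1 = i ∨ (u.card = D ∧ (i : ℕ) + 1 = D)
  · simp only [if_pos hc, Finset.mul_sum]
  · simp only [if_neg hc, Finset.sum_const_zero]

theorem basisMatrix_conjTranspose_mul_self [∀ r, DecidableEq (ι r)] :
    (basisMatrix D b)ᴴ * basisMatrix D b = 1 := by
  ext ⟨r, ξ, i⟩ ⟨r', ξ', i'⟩
  rw [Matrix.mul_apply, Matrix.one_apply]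
  simp only [Matrix.conjTranspose_apply]
  by_cases hii : (i : ℕ) = i'
  · have h1 := sum_ofSet_powersetCard (D := D) (by have := r.2; omega) (blockIndex_bounds i).2.1
      (f := fun x => star (basisMatrix D b x ⟨r, ξ, i⟩) * basisMatrix D b x ⟨r', ξ', i'⟩)
      (fun x hx => by rw [basisMatrix_apply_of_ne b hx, star_zero, zero_mul])
    have h2 : ∑ u ∈ Finset.univ.powersetCard (i : ℕ),
        star (basisMatrix D b (ofSet u) ⟨r, ξ, i⟩) * basisMatrix D b (ofSet u) ⟨r', ξ', i'⟩ =
        (columnFactor D r i * columnFactor D r' i) *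
          ∑ u ∈ Finset.univ.powersetCard (i : ℕ),
            subsetSum (star (basisLift b r ξ)) u * subsetSum (basisLift b r' ξ') u := by
      rw [Finset.mul_sum]
      refine Finset.sum_congr rfl fun u hu => ?_
      have hu := (Finset.mem_powersetCard.1 hu).2
      rw [basisMatrix_ofSet b hu, basisMatrix_ofSet b (hu.trans hii), subsetSum_star, star_mul',
        hii]
      simp only [Complex.star_def, Complex.conj_ofReal]
      ring
    rw [h2] at h1
    -- The harmonic identities sum over `i`-sets, so the inner product over vertices is compared
    -- after multiplication by the level weight.
    refine mul_left_cancel₀ (levelWeight_ne_zero D i) (h1.symm.trans ?_)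
    by_cases hrr : r = r'
    · subst hrr
      obtain rfl : i = i' := Subtype.ext hii
      have hb := blockIndex_bounds i
      have h3 := sum_subsetSum_mul (isHarmonic_basisLift b r ξ).star (isHarmonic_basisLift b r ξ')
        (i - r) (by rw [Fintype.card_fin]; omega)
      rw [Nat.add_sub_cancel' hb.1, Fintype.card_fin] at h3
      have h4 : ∑ v, star (basisLift b r ξ) v * basisLift b r ξ' v = if ξ = ξ' then 1 else 0 := by
        rw [basisLift, basisLift, sum_levelLift_star_mul r.2 (b r ξ).2, ← Submodule.coe_inner]
        exact orthonormal_iff_ite.1 (b r).orthonormal ξ ξ'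
      rw [h3, ← mul_assoc, columnFactor_mul_self r.2 hb.2.1, h4]
      simp
    · rw [sum_subsetSum_mul_of_ne (isHarmonic_basisLift b r ξ).star (isHarmonic_basisLift b r' ξ')
        (fun h => hrr (Fin.ext h)), if_neg (show ¬ (⟨r, ξ, i⟩ : TripleIndex D ι) = ⟨r', ξ', i'⟩ from
          fun h => hrr (congrArg Sigma.fst h))]
      simp
  · rw [if_neg, Finset.sum_eq_zero]
    · intro x _
      by_cases hx : sep (zero (2 * D)) x = i
      · rw [basisMatrix_apply_of_ne b (show sep (zero (2 * D)) x ≠ i' by omega), mul_zero]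
      · rw [basisMatrix_apply_of_ne b hx, star_zero, zero_mul]
    · intro h
      cases h
      exact hii rfl

end Columns

/-! ### Dimensions -/

section Dimension

open FoldedVertex

theorem sum_range_choose_succ (N m : ℕ) :
    ∑ k ∈ Finset.range (m + 1), ((N + 1).choose k : ℤ) =
      2 * ∑ k ∈ Finset.range (m + 1), (N.choose k : ℤ) - N.choose m := by
  induction m with
  | zero => simp
  | succ m ih =>
    rw [Finset.sum_range_succ, ih, Finset.sum_range_succ _ (m + 1), Nat.choose_succ_succ]
    push_cast
    ring

/-- The difference of two consecutive binomial coefficients. -/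
def chooseDiff (n r : ℕ) : ℤ := n.choose r - (if r = 0 then 0 else (n.choose (r - 1) : ℤ))

theorem sum_chooseDiff (n m : ℕ) :
    ∑ r ∈ Finset.range (m + 1), chooseDiff n r = n.choose m := by
  induction m with
  | zero => simp [chooseDiff]
  | succ m ih => rw [Finset.sum_range_succ, ih]; simp [chooseDiff]

/-- Summation by parts: each binomial on the right is a partial sum of differences, and the `r`-th
difference occurs in `m - r` of them. -/
theorem sum_chooseDiff_mul (n m : ℕ) :
    ∑ r ∈ Finset.range m, chooseDiff n r * ((m : ℤ) - r) =
      ∑ k ∈ Finset.range m, (n.choose k : ℤ) := by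
  induction m with
  | zero => simp
  | succ m ih =>
    rw [Finset.sum_range_succ (fun k => (n.choose k : ℤ)) m, ← ih, ← sum_chooseDiff,
      Finset.sum_range_succ, Finset.sum_range_succ _ m, ← add_assoc, ← Finset.sum_add_distrib]
    push_cast
    congr 1
    · exact Finset.sum_congr rfl fun r _ => by ring
    · ring

/-- By Pascal's rule `chooseDiff (N + 1) r` is `N.choose r - N.choose (r - 2)` for `r ≥ 2`, which
telescopes over even `r`. -/
theorem sum_chooseDiff_even (N l : ℕ) :
    ∑ r ∈ Finset.range (2 * l + 1), (if Even r then chooseDiff (N + 1) r else 0) =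
      N.choose (2 * l) := by
  induction l with
  | zero => simp [chooseDiff]
  | succ l ih =>
    rw [show 2 * (l + 1) + 1 = 2 * l + 1 + 1 + 1 by ring, Finset.sum_range_succ,
      Finset.sum_range_succ, ih, if_neg (by simp [parity_simps]), if_pos (by simp [parity_simps]),
      chooseDiff, if_neg (by omega), Nat.add_one_sub_one, Nat.choose_succ_succ,
      Nat.choose_succ_succ]
    push_cast
    rw [show 2 * (l + 1) = 2 * l + 1 + 1 by ring]
    ring

theorem card_blockIndex {D : ℕ} (r : Fin D) :
    (Fintype.card (BlockIndex D r) : ℤ) = (D : ℤ) - r + if Even (r : ℕ) then 1 else 0 := by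
  have := r.2
  rw [Fintype.card_coe, Nat.card_Icc]
  split_ifs <;> omega

/-- For odd `D` the last index `D - 1` is even, so the extra level in the even blocks contributes
`(2 * D - 1).choose (D - 1)`. This is what the lower half of the row `2 * D` lacks to reach `2 ^ (2
* D - 1)`. -/
theorem sum_chooseDiff_mul_card {D : ℕ} (hodd : Odd D) :
    ∑ r : Fin D, chooseDiff (2 * D) r * (Fintype.card (BlockIndex D r) : ℤ) =
      2 ^ (2 * D - 1) := by
  obtain ⟨l, rfl⟩ := hodd
  simp only [card_blockIndex]
  rw [Fin.sum_univ_eq_sum_range (fun r => chooseDiff (2 * (2 * l + 1)) r *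
    (((2 * l + 1 : ℕ) : ℤ) - r + if Even r then 1 else 0))]
  simp only [mul_add, Finset.sum_add_distrib, mul_ite, mul_one, mul_zero]
  have h1 := sum_chooseDiff_mul (2 * (2 * l + 1)) (2 * l + 1)
  simp only [mul_add, mul_one] at h1
  rw [h1, show 2 * (2 * l) + 2 = (2 * (2 * l) + 1) + 1 by ring, sum_range_choose_succ,
    sum_chooseDiff_even]
  have h2 := congrArg (Nat.cast : ℕ → ℤ) (Nat.sum_range_choose_halfway (2 * l))
  push_cast at h2
  have h3 : (4 : ℤ) ^ (2 * l) = 2 ^ (2 * (2 * l)) := by rw [pow_mul 2 2]; norm_num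
  rw [h2, h3, Nat.add_sub_cancel, pow_succ]
  ring

theorem two_mul_card_foldedVertex {n : ℕ} (hn : 0 < n) :
    2 * Fintype.card (FoldedVertex n) = 2 ^ n := by
  have h := sum_comp_ofSet hn (fun _ => 1)
  simpa using h.symm

theorem card_sep_zero_eq {D r : ℕ} (hr : r < D) :
    Fintype.card {x : FoldedVertex (2 * D) // sep (zero (2 * D)) x = r} = (2 * D).choose r := by
  have h := sum_ofSet_powersetCard (D := D) (by omega) hr.le (i := r)
    (f := fun x => if sep (zero (2 * D)) x = r then 1 else 0) (fun x hx => if_neg hx)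
  rw [levelWeight, if_neg hr.ne, one_mul] at h
  have h2 : ∀ u ∈ Finset.univ.powersetCard r,
      (if sep (zero (2 * D)) (ofSet u) = r then (1 : ℂ) else 0) = 1 := by
    intro u hu
    rw [sep_zero_ofSet, (Finset.mem_powersetCard.1 hu).2, if_pos (by omega)]
  rw [Finset.sum_congr rfl h2] at h
  rw [Fintype.card_subtype]
  simp at h
  exact_mod_cast h.symm

theorem finrank_le_finrank_ker_add {E F : Type*} [AddCommGroup E] [Module ℂ E] [AddCommGroup F]
    [Module ℂ F] [FiniteDimensional ℂ E] [FiniteDimensional ℂ F] (f : E →ₗ[ℂ] F)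
    {K : Submodule ℂ E} (hK : LinearMap.ker f = K) :
    Module.finrank ℂ E ≤ Module.finrank ℂ F + Module.finrank ℂ K := by
  rw [← f.finrank_range_add_finrank_ker, hK]
  exact Nat.add_le_add_right (LinearMap.range f).finrank_le _

/-- Rank-nullity: the space is cut out by one equation for each vertex off level `r` and, if `r >
0`, one for each vertex of level `r - 1`. -/
theorem chooseDiff_le_finrank_lowestSpace {D r : ℕ} (hr : r < D) :
    chooseDiff (2 * D) r ≤ Module.finrank ℂ (lowestSpace D r) := by
  let O := {x : FoldedVertex (2 * D) // ¬ sep (zero (2 * D)) x = r}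
  let res : EuclideanSpace ℂ (FoldedVertex (2 * D)) →ₗ[ℂ] (O → ℂ) :=
    { toFun := fun ξ x => ξ x.1, map_add' := fun _ _ => rfl, map_smul' := fun _ _ => rfl }
  have hO : Fintype.card O = Fintype.card (FoldedVertex (2 * D)) - (2 * D).choose r := by
    rw [Fintype.card_subtype_compl, card_sep_zero_eq hr]
  have hXle : (2 * D).choose r ≤ Fintype.card (FoldedVertex (2 * D)) := by
    rw [← card_sep_zero_eq hr]
    exact Fintype.card_subtype_le _
  rcases Nat.eq_zero_or_pos r with rfl | hr0
  · have h1 := finrank_le_finrank_ker_add res (K := lowestSpace D 0) (by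
      ext ξ
      rw [LinearMap.mem_ker]
      constructor
      · exact fun h => ⟨fun k hk => absurd hk k.succ_ne_zero, fun x hx => congrFun h ⟨x, hx⟩⟩
      · exact fun h => funext fun x => h.2 x.1 x.2)
    rw [finrank_euclideanSpace, Module.finrank_fintype_fun_eq_card, hO] at h1
    simp only [chooseDiff, if_pos]
    omega
  · let Y := {x : FoldedVertex (2 * D) // sep (zero (2 * D)) x = r - 1}
    let down : EuclideanSpace ℂ (FoldedVertex (2 * D)) →ₗ[ℂ] (Y → ℂ) :=
      { toFun := fun ξ x => (orbitMatrix D (r - 1) r (r - 1) *ᵥ ξ.ofLp) x.1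
        map_add' := fun ξ η => funext fun x => by
          rw [WithLp.ofLp_add, Matrix.mulVec_add]; rfl
        map_smul' := fun c ξ => funext fun x => by
          rw [WithLp.ofLp_smul, Matrix.mulVec_smul]; rfl }
    have h1 := finrank_le_finrank_ker_add (down.prod res) (K := lowestSpace D r) (by
      ext ξ
      rw [LinearMap.ker_prod, Submodule.mem_inf, LinearMap.mem_ker, LinearMap.mem_ker]
      constructor
      · rintro ⟨h1, h2⟩
        refine ⟨fun k hk => funext fun x => ?_, fun x hx => congrFun h2 ⟨x, hx⟩⟩
        obtain rfl : k = r - 1 := by omega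
        by_cases hx : sep (zero (2 * D)) x = r - 1
        · exact congrFun h1 ⟨x, hx⟩
        · exact orbitMatrix_mulVec_apply_of_ne hx _
      · intro h
        exact ⟨funext fun x => congrFun (h.1 (r - 1) (by omega)) x.1, funext fun x => h.2 x.1 x.2⟩)
    have hY : Fintype.card Y = (2 * D).choose (r - 1) := card_sep_zero_eq (by omega)
    rw [finrank_euclideanSpace, Module.finrank_prod, Module.finrank_fintype_fun_eq_card,
      Module.finrank_fintype_fun_eq_card, hO, hY] at h1
    simp only [chooseDiff, if_neg hr0.ne']
    omega

variable {D : ℕ} {ι : Fin D → Type*} [∀ r, Fintype (ι r)]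

theorem card_tripleIndex :
    Fintype.card (TripleIndex D ι) = ∑ r, Fintype.card (ι r) * Fintype.card (BlockIndex D r) := by
  rw [Fintype.card_sigma]
  exact Finset.sum_congr rfl fun r _ => Fintype.card_prod _ _

theorem card_tripleIndex_le [∀ r, DecidableEq (ι r)]
    (b : ∀ r : Fin D, OrthonormalBasis (ι r) ℂ (lowestSpace D r)) :
    Fintype.card (TripleIndex D ι) ≤ Fintype.card (FoldedVertex (2 * D)) := by
  have h := congrArg Matrix.rank (basisMatrix_conjTranspose_mul_self b)
  rw [Matrix.rank_one] at h
  rw [← h]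
  exact (Matrix.rank_mul_le_right _ _).trans (Matrix.rank_le_card_height _)

/-- A squeeze: every dimension is at least its binomial difference, while the total weighted by the
positive block sizes is at most `2 ^ (2 * D - 1)`, the value attained by the differences themselves.
-/
theorem card_index_eq [∀ r, DecidableEq (ι r)]
    (b : ∀ r : Fin D, OrthonormalBasis (ι r) ℂ (lowestSpace D r)) (hodd : Odd D) (r : Fin D) :
    (Fintype.card (ι r) : ℤ) = chooseDiff (2 * D) r := by
  have hle : ∀ r : Fin D, chooseDiff (2 * D) r ≤ (Fintype.card (ι r) : ℤ) := fun r => by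
    rw [← Module.finrank_eq_card_basis (b r).toBasis]
    exact chooseDiff_le_finrank_lowestSpace r.2
  have hpos : ∀ r : Fin D, (0 : ℤ) < Fintype.card (BlockIndex D r) := fun r => by
    have := r.2
    rw [card_blockIndex]
    split_ifs <;> omega
  have hD := r.2
  have h1 : ((∑ r, Fintype.card (ι r) * Fintype.card (BlockIndex D r) : ℕ) : ℤ) ≤
      ∑ r : Fin D, chooseDiff (2 * D) r * (Fintype.card (BlockIndex D r) : ℤ) := by
    rw [sum_chooseDiff_mul_card hodd, ← card_tripleIndex]
    have h2 := two_mul_card_foldedVertex (show 0 < 2 * D by omega)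
    have h3 := card_tripleIndex_le b
    have h4 : 2 * 2 ^ (2 * D - 1) = 2 ^ (2 * D) := by
      rw [← pow_succ']; congr 1; omega
    exact_mod_cast (by omega : Fintype.card (TripleIndex D ι) ≤ 2 ^ (2 * D - 1))
  push_cast at h1
  have h2 := (Finset.sum_eq_sum_iff_of_le fun r _ =>
    mul_le_mul_of_nonneg_right (hle r) (hpos r).le).1
    (le_antisymm (Finset.sum_le_sum fun r _ => mul_le_mul_of_nonneg_right (hle r) (hpos r).le) h1)
  exact (mul_right_cancel₀ (hpos r).ne' (h2 r (Finset.mem_univ r))).symm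

theorem card_tripleIndex_eq [∀ r, DecidableEq (ι r)]
    (b : ∀ r : Fin D, OrthonormalBasis (ι r) ℂ (lowestSpace D r)) (hodd : Odd D) :
    Fintype.card (TripleIndex D ι) = Fintype.card (FoldedVertex (2 * D)) := by
  have h1 := sum_chooseDiff_mul_card hodd
  simp only [← card_index_eq b hodd] at h1
  have h2 := two_mul_card_foldedVertex (show 0 < 2 * D by have := hodd.pos; omega)
  have h4 : 2 * 2 ^ (2 * D - 1) = 2 ^ (2 * D) := by
    have := hodd.pos
    rw [← pow_succ']; congr 1; omega
  rw [card_tripleIndex]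
  have h3 : ∑ r, Fintype.card (ι r) * Fintype.card (BlockIndex D r) = 2 ^ (2 * D - 1) := by
    exact_mod_cast h1
  omega

theorem basisMatrix_mul_conjTranspose_self [∀ r, DecidableEq (ι r)]
    (b : ∀ r : Fin D, OrthonormalBasis (ι r) ℂ (lowestSpace D r)) (hodd : Odd D) :
    basisMatrix D b * (basisMatrix D b)ᴴ = 1 :=
  (Matrix.mul_eq_one_comm_of_card_eq _ _ _ (card_tripleIndex_eq b hodd)).1
    (basisMatrix_conjTranspose_mul_self b)

/-- Binomial coefficients increase strictly up to the middle. Every block therefore occurs, which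
makes `blockEmbedding` injective. -/
theorem nonempty_index [∀ r, DecidableEq (ι r)]
    (b : ∀ r : Fin D, OrthonormalBasis (ι r) ℂ (lowestSpace D r)) (hodd : Odd D) (r : Fin D) :
    Nonempty (ι r) := by
  rw [← Fintype.card_pos_iff]
  have h := card_index_eq b hodd r
  have hr := r.2
  have hpos : 0 < chooseDiff (2 * D) r := by
    unfold chooseDiff
    split_ifs with h0
    · simp [h0]
    · obtain ⟨k, hk⟩ := Nat.exists_eq_succ_of_ne_zero h0
      rw [hk, Nat.succ_sub_one, sub_pos, Nat.cast_lt]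
      have h1 := Nat.choose_succ_right_eq (2 * D) k
      have h2 : 0 < (2 * D).choose k := Nat.choose_pos (by omega)
      by_contra hle
      have h3 : (2 * D).choose (k + 1) * (k + 1) ≤ (2 * D).choose k * (k + 1) :=
        Nat.mul_le_mul_right _ (not_lt.1 hle)
      rw [h1] at h3
      have := Nat.le_of_mul_le_mul_left h3 h2
      omega
  omega

end Dimension

/-! ### Subalgebras of the product of matrix algebras -/

section Generation

variable {D : ℕ}

/-- The product of matrix algebras in which a member of the Terwilliger algebra has its blocks. -/
abbrev BlockAlgebra (D : ℕ) : Type :=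
  (r : Fin D) → Matrix (BlockIndex D r) (BlockIndex D r) ℂ

/-- The blocks of the `i`-th dual idempotent. -/
noncomputable def levelIdempotent (D i : ℕ) : BlockAlgebra D := fun _ =>
  Matrix.diagonal fun j => if (j : ℕ) = i then 1 else 0

theorem sum_single_eq_levelIdempotent (i : ℕ) :
    ∑ r : Fin D, ∑ j : BlockIndex D r, (if (j : ℕ) = i then
      Pi.single r (Matrix.single j j 1) else 0 : BlockAlgebra D) = levelIdempotent D i := by
  funext s
  rw [Finset.sum_apply, Finset.sum_eq_single s]
  · ext a c
    rw [Finset.sum_apply, Matrix.sum_apply, Finset.sum_eq_single a, levelIdempotent,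
      Matrix.diagonal_apply]
    · by_cases h : (a : ℕ) = i
      · rw [if_pos h, if_pos h, Pi.single_eq_same, Matrix.single_apply]
        simp
      · rw [if_neg h, if_neg h, ite_self]
        rfl
    · intro j _ hja
      by_cases h : (j : ℕ) = i
      · rw [if_pos h, Pi.single_eq_same, Matrix.single_apply_of_row_ne hja]
      · rw [if_neg h]
        rfl
    · exact fun h => absurd (Finset.mem_univ a) h
  · intro r _ hrs
    rw [Finset.sum_apply]
    refine Finset.sum_eq_zero fun j _ => ?_
    by_cases h : (j : ℕ) = i
    · rw [if_pos h]
      exact Pi.single_eq_of_ne hrs.symm _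
    · rw [if_neg h]
      rfl
  · exact fun h => absurd (Finset.mem_univ s) h

theorem diagonal_mul_mul_single {r : ℕ} (M : Matrix (BlockIndex D r) (BlockIndex D r) ℂ)
    (i k o : BlockIndex D r) :
    (Matrix.diagonal fun j : BlockIndex D r => if (j : ℕ) = i then (1 : ℂ) else 0) *
      (M * Matrix.single k o 1) = M i k • Matrix.single i o 1 := by
  ext a c
  rw [Matrix.diagonal_mul, Matrix.smul_apply]
  by_cases ha : i = a
  · subst ha
    by_cases hc : o = c
    · subst hc; simp
    · rw [Matrix.mul_single_apply_of_ne _ _ _ _ _ (Ne.symm hc)]; simp [hc]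
  · have : ¬ (a : ℕ) = i := fun h => ha (Subtype.ext h.symm)
    simp [ha, this]

theorem single_mul_mul_diagonal {r : ℕ} (M : Matrix (BlockIndex D r) (BlockIndex D r) ℂ)
    (i k o : BlockIndex D r) :
    Matrix.single o k 1 * M *
      (Matrix.diagonal fun j : BlockIndex D r => if (j : ℕ) = i then (1 : ℂ) else 0) =
        M k i • Matrix.single o i 1 := by
  ext a c
  rw [Matrix.mul_diagonal, Matrix.smul_apply]
  by_cases hc : i = c
  · subst hc
    by_cases ha : o = a
    · subst ha; simp
    · rw [Matrix.single_mul_apply_of_ne _ _ _ _ _ (Ne.symm ha)]; simp [ha]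
  · have : ¬ (c : ℕ) = i := fun h => hc (Subtype.ext h.symm)
    simp [hc, this]

/-- A subalgebra of the product of matrix algebras that contains the idempotents of every level
and an element with nonzero entries next to the diagonal is the whole product. -/
theorem subalgebra_eq_top
    (S : Subalgebra ℂ (BlockAlgebra D)) (A : BlockAlgebra D) (hA : A ∈ S)
    (hE : ∀ i, levelIdempotent D i ∈ S)
    (hne : ∀ (r : Fin D) (i j : BlockIndex D r), (j : ℕ) = i + 1 → A r j i ≠ 0 ∧ A r i j ≠ 0) :
    S = ⊤ := by
  have key : ∀ (r : Fin D) (i j : BlockIndex D r),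
      (Pi.single r (Matrix.single i j 1) : BlockAlgebra D) ∈ S := by
    intro r
    induction r using WellFoundedLT.induction with
    | _ r ih =>
    let o : BlockIndex D r := ⟨r, Finset.mem_Icc.2 ⟨le_rfl, by have := r.2; split_ifs <;> omega⟩⟩
    have hoo : (Pi.single r (Matrix.single o o 1) : BlockAlgebra D) ∈ S := by
      -- Level `r` occurs only in blocks `s ≤ r`. Removing the matrix units of the blocks `s < r`,
      -- known by induction, isolates the first diagonal unit of block `r`.
      have h := hE r
      rw [← sum_single_eq_levelIdempotent, ← Finset.add_sum_erase _ _ (Finset.mem_univ r)] at h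
      have hrest : ∑ s ∈ Finset.univ.erase r, ∑ j : BlockIndex D s, (if (j : ℕ) = r then
          Pi.single s (Matrix.single j j 1) else 0 : BlockAlgebra D) ∈ S := by
        refine sum_mem fun s hs => sum_mem fun j _ => ?_
        by_cases hj : (j : ℕ) = r
        · rw [if_pos hj]
          refine ih s (lt_of_le_of_ne ?_ (Finset.ne_of_mem_erase hs)) j j
          have := (blockIndex_bounds j).1
          exact Fin.le_def.2 (by omega)
        · rw [if_neg hj]
          exact zero_mem S
      have hsub := sub_mem h hrest
      rw [add_sub_cancel_right, Finset.sum_eq_single o, if_pos rfl] at hsub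
      · exact hsub
      · exact fun j _ hj => if_neg fun h => hj (Subtype.ext h)
      · exact fun h => absurd (Finset.mem_univ o) h
    have hio : ∀ (k : ℕ) (i : BlockIndex D r), (i : ℕ) = r + k →
        (Pi.single r (Matrix.single i o 1) : BlockAlgebra D) ∈ S ∧
          (Pi.single r (Matrix.single o i 1) : BlockAlgebra D) ∈ S := by
      intro k
      induction k with
      | zero =>
        intro i hi
        obtain rfl : i = o := Subtype.ext hi
        exact ⟨hoo, hoo⟩
      | succ k ihk =>
        intro i hi
        let j : BlockIndex D r := ⟨r + k, Finset.mem_Icc.2 ⟨by omega, by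
          have := (Finset.mem_Icc.1 i.2).2
          omega⟩⟩
        obtain ⟨h1, h2⟩ := ihk j rfl
        obtain ⟨n1, n2⟩ := hne r j i (by simp only [j]; omega)
        constructor
        -- Multiplying by `A` and cutting down to level `i` moves the unit from `j` to its neighbour
        -- `i`, up to the nonzero entry `A r i j`.
        · have h3 := Subalgebra.smul_mem S (mul_mem (hE i) (mul_mem hA h1)) (A r i j)⁻¹
          convert h3 using 1
          funext s
          by_cases hs : s = r
          · subst hs
            simp only [Pi.smul_apply, Pi.mul_apply, Pi.single_eq_same, levelIdempotent]
            rw [diagonal_mul_mul_single, inv_smul_smul₀ n1]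
          · simp [Pi.single_eq_of_ne hs]
        · have h3 := Subalgebra.smul_mem S (mul_mem (mul_mem h2 hA) (hE i)) (A r j i)⁻¹
          convert h3 using 1
          funext s
          by_cases hs : s = r
          · subst hs
            simp only [Pi.smul_apply, Pi.mul_apply, Pi.single_eq_same, levelIdempotent]
            rw [single_mul_mul_diagonal, inv_smul_smul₀ n2]
          · simp [Pi.single_eq_of_ne hs]
    intro i j
    have h1 := (hio (i - r) i (by have := (blockIndex_bounds i).1; omega)).1
    have h2 := (hio (j - r) j (by have := (blockIndex_bounds j).1; omega)).2
    have h3 := mul_mem h1 h2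
    rwa [← Pi.single_mul, Matrix.single_mul_single_same, mul_one] at h3
  refine top_unique fun C _ => ?_
  have hC : C = ∑ r, Pi.single r (C r) := (Finset.univ_sum_single C).symm
  rw [hC]
  refine sum_mem fun r _ => ?_
  have h4 : Pi.single r (C r) =
      ∑ i, ∑ j, C r i j • (Pi.single r (Matrix.single i j 1) : BlockAlgebra D) := by
    conv_lhs => rw [Matrix.matrix_eq_sum_single (C r)]
    funext s
    by_cases hs : s = r
    · subst hs
      simp [Finset.sum_apply, Matrix.smul_single]
    · simp [Finset.sum_apply, Pi.single_eq_of_ne hs]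
  rw [h4]
  exact sum_mem fun i _ => sum_mem fun j _ => S.smul_mem (key r i j) _

end Generation

/-! ### The action of the generators on the columns of `U₂` -/

section Action

open FoldedVertex

variable {D : ℕ} {ι : Fin D → Type*} [∀ r, DecidableEq (ι r)]

theorem repeatedBlocks_one : repeatedBlocks D (ι := ι) 1 = 1 := by
  have : (fun r : Fin D => (1 : Matrix (ι r) (ι r) ℂ) ⊗ₖ (1 : BlockAlgebra D) r) = 1 :=
    funext fun r => Matrix.one_kronecker_one
  rw [repeatedBlocks, this, Matrix.blockDiagonal'_one]

theorem repeatedBlocks_mul [∀ r, Fintype (ι r)] (A B : BlockAlgebra D) :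
    repeatedBlocks D (ι := ι) (A * B) =
      repeatedBlocks D (ι := ι) A * repeatedBlocks D (ι := ι) B := by
  rw [repeatedBlocks, repeatedBlocks, repeatedBlocks, ← Matrix.blockDiagonal'_mul]
  congr 1
  funext r
  rw [← Matrix.mul_kronecker_mul, one_mul, Pi.mul_apply]

theorem repeatedBlocks_add (A B : BlockAlgebra D) :
    repeatedBlocks D (ι := ι) (A + B) =
      repeatedBlocks D (ι := ι) A + repeatedBlocks D (ι := ι) B := by
  rw [repeatedBlocks, repeatedBlocks, repeatedBlocks, ← Matrix.blockDiagonal'_add]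
  congr 1
  funext r
  rw [Pi.add_apply, Pi.add_apply, Matrix.kronecker_add]

theorem repeatedBlocks_smul (c : ℂ) (A : BlockAlgebra D) :
    repeatedBlocks D (ι := ι) (c • A) = c • repeatedBlocks D (ι := ι) A := by
  rw [repeatedBlocks, repeatedBlocks, ← Matrix.blockDiagonal'_smul]
  congr 1
  funext r
  rw [Pi.smul_apply, Pi.smul_apply, Matrix.kronecker_smul]

theorem repeatedBlocks_apply_self (C : BlockAlgebra D) (r : Fin D) (ξ : ι r)
    (i j : BlockIndex D r) : repeatedBlocks D (ι := ι) C ⟨r, ξ, i⟩ ⟨r, ξ, j⟩ = C r i j := by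
  rw [repeatedBlocks, Matrix.blockDiagonal'_apply_eq, Matrix.kronecker_apply, Matrix.one_apply_eq,
    one_mul]

theorem repeatedBlocks_injective [∀ r, Nonempty (ι r)] :
    Function.Injective (repeatedBlocks D (ι := ι)) := by
  intro A B h
  funext r
  ext i j
  obtain ⟨ξ⟩ := (inferInstance : Nonempty (ι r))
  rw [← repeatedBlocks_apply_self (ι := ι) A r ξ, h, repeatedBlocks_apply_self]

theorem mul_repeatedBlocks_apply [∀ r, Fintype (ι r)] {X : Type*} (U : Matrix X (TripleIndex D ι) ℂ)
    (C : BlockAlgebra D) (x : X) (r : Fin D) (ξ : ι r) (i : BlockIndex D r) :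
    (U * repeatedBlocks D (ι := ι) C) x ⟨r, ξ, i⟩ = ∑ k, U x ⟨r, ξ, k⟩ * C r k i := by
  rw [Matrix.mul_apply, Fintype.sum_sigma, Finset.sum_eq_single r, Fintype.sum_prod_type,
    Finset.sum_eq_single ξ]
  · exact Finset.sum_congr rfl fun k _ => by rw [repeatedBlocks_apply_self]
  · intro η _ hη
    refine Finset.sum_eq_zero fun k _ => ?_
    rw [repeatedBlocks, Matrix.blockDiagonal'_apply_eq, Matrix.kronecker_apply,
      Matrix.one_apply_ne hη, zero_mul, mul_zero]
  · exact fun h => absurd (Finset.mem_univ ξ) h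
  · intro s _ hs
    refine Finset.sum_eq_zero fun p _ => ?_
    rw [repeatedBlocks, Matrix.blockDiagonal'_apply_ne _ _ _ hs, mul_zero]
  · exact fun h => absurd (Finset.mem_univ r) h

variable [∀ r, Fintype (ι r)]
  (b : ∀ r : Fin D, OrthonormalBasis (ι r) ℂ (lowestSpace D r))

theorem dualIdempotent_mul_basisMatrix (hD : 2 ≤ D) (i : ℕ) :
    dualIdempotent (foldedCube (2 * D)) (zero (2 * D)) i * basisMatrix D b =
      basisMatrix D b * repeatedBlocks D (ι := ι) (levelIdempotent D i) := by
  have hdiag : dualIdempotent (foldedCube (2 * D)) (zero (2 * D)) i =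
      Matrix.diagonal fun y => if (foldedCube (2 * D)).dist (zero (2 * D)) y = i then 1 else 0 := by
    unfold dualIdempotent
    congr!
  ext x ⟨r, ξ, k⟩
  rw [mul_repeatedBlocks_apply, hdiag, Matrix.diagonal_mul, foldedCube_dist (by omega),
    Finset.sum_eq_single k]
  · rw [levelIdempotent, Matrix.diagonal_apply_eq]
    by_cases hx : sep (zero (2 * D)) x = k
    · rw [hx, mul_comm]
    · rw [basisMatrix_apply_of_ne b hx, mul_zero, zero_mul]
  · intro j _ hj
    rw [levelIdempotent, Matrix.diagonal_apply_ne _ hj, mul_zero]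
  · exact fun h => absurd (Finset.mem_univ k) h

/-- The blocks of the adjacency matrix of the folded cube. -/
noncomputable def adjacencyBlocks (D : ℕ) : BlockAlgebra D := fun r => Matrix.of fun k i =>
  (columnFactor D r i : ℂ) / columnFactor D r k *
    ((if (k : ℕ) = i + 1 then ((k : ℕ) - (r : ℕ) : ℂ) * levelWeight D k else 0) +
      if (k : ℕ) + 1 = i then (2 * D - (k : ℕ) - (r : ℕ) : ℂ) else 0)

theorem adjacencyBlocks_ne_zero {r : Fin D} {i j : BlockIndex D r} (h : (j : ℕ) = i + 1) :
    adjacencyBlocks D r j i ≠ 0 ∧ adjacencyBlocks D r i j ≠ 0 := by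
  have hi := blockIndex_bounds i
  have hj := blockIndex_bounds j
  have hr := r.2
  have ci : (columnFactor D r i : ℂ) ≠ 0 := by exact_mod_cast (columnFactor_pos hr hi.2.1).ne'
  have cj : (columnFactor D r j : ℂ) ≠ 0 := by exact_mod_cast (columnFactor_pos hr hj.2.1).ne'
  constructor
  · rw [adjacencyBlocks, Matrix.of_apply, if_pos h,
      if_neg (show ¬ (j : ℕ) + 1 = i by omega), add_zero]
    refine mul_ne_zero (div_ne_zero ci cj) (mul_ne_zero ?_ (levelWeight_ne_zero D j))
    rw [sub_ne_zero]
    exact_mod_cast (by omega : (j : ℕ) ≠ r)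
  · rw [adjacencyBlocks, Matrix.of_apply, if_neg (show ¬ (i : ℕ) = j + 1 by omega),
      if_pos h.symm, zero_add]
    refine mul_ne_zero (div_ne_zero cj ci) ?_
    rw [sub_sub, sub_ne_zero]
    exact_mod_cast (by omega : 2 * D ≠ (i : ℕ) + r)

/-- Neighbours arise by deletion or insertion, and both reproduce the same subset sum. At level `D`
with even `r` they contribute equally, which is the factor `levelWeight` in the blocks. -/
theorem distMatrix_one_mul_basisMatrix (hD : 2 ≤ D) :
    distMatrix (foldedCube (2 * D)) 1 * basisMatrix D b =
      basisMatrix D b * repeatedBlocks D (ι := ι) (adjacencyBlocks D) := by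
  ext x ⟨r, ξ, i⟩
  obtain ⟨u, rfl, hu⟩ := exists_ofSet_eq x
  have huD : u.card ≤ D := hu ▸ sep_zero_le _
  have hi := blockIndex_bounds i
  have hr := r.2
  have h1 : (distMatrix (foldedCube (2 * D)) 1 * basisMatrix D b) (ofSet u) ⟨r, ξ, i⟩ =
      ∑ a, basisMatrix D b (ofSet (symmDiff u {a})) ⟨r, ξ, i⟩ :=
    distMatrix_one_mulVec (by omega) (fun x => basisMatrix D b x ⟨r, ξ, i⟩) u
  rw [h1, sum_symmDiff_singleton (fun w => basisMatrix D b (ofSet w) ⟨r, ξ, i⟩),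
    sum_basisMatrix_erase b huD, sum_basisMatrix_insert b huD, mul_repeatedBlocks_apply]
  simp only [basisMatrix_ofSet_of_le b huD, ite_mul, zero_mul]
  by_cases hmem : u.card ∈ Finset.Icc (r : ℕ) (if Even (r : ℕ) then D else D - 1)
  · let k : BlockIndex D r := ⟨u.card, hmem⟩
    have hk := blockIndex_bounds k
    have ck : (columnFactor D r k : ℂ) ≠ 0 := by exact_mod_cast (columnFactor_pos hr hk.2.1).ne'
    rw [Finset.sum_eq_single k (fun j _ hj => if_neg fun h => hj (Subtype.ext h.symm))
      (fun h => absurd (Finset.mem_univ k) h), if_pos rfl, adjacencyBlocks, Matrix.of_apply]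
    have hku : (k : ℕ) = u.card := rfl
    have e : ∀ Z W : ℂ, (columnFactor D r k : ℂ) * Z *
        ((columnFactor D r i : ℂ) / columnFactor D r k * W) = columnFactor D r i * (W * Z) := by
      intro Z W
      field_simp
    rw [e, hku, levelWeight]
    by_cases hD' : u.card = D
    · have hev : Even (r : ℕ) := hk.2.2 hD'
      rw [if_neg (show ¬ u.card + 1 = i by omega)]
      by_cases hiD : u.card = i + 1
      · rw [if_pos hiD, if_pos (Or.inr ⟨hD', by omega⟩), if_pos hD', if_pos hiD, if_pos hD', hD',
          hev.neg_one_pow]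
        ring
      · rw [if_neg hiD, if_neg (show ¬ (u.card + 1 = i ∨ (u.card = D ∧ (i : ℕ) + 1 = D)) by omega),
          if_neg hiD]
        simp
    · by_cases hiD : u.card = i + 1
      · rw [if_pos hiD, if_neg (show ¬ (u.card + 1 = i ∨ (u.card = D ∧ (i : ℕ) + 1 = D)) by omega),
          if_pos hiD, if_neg hD', if_neg (show ¬ u.card + 1 = i by omega)]
        ring
      · rw [if_neg hiD, if_neg hiD, if_neg hD']
        by_cases hiD' : u.card + 1 = i
        · rw [if_pos (Or.inl hiD'), if_pos hiD']
          ring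
        · rw [if_neg (show ¬ (u.card + 1 = i ∨ (u.card = D ∧ (i : ℕ) + 1 = D)) by omega),
            if_neg hiD']
          simp
  · rw [Finset.sum_eq_zero fun (k : BlockIndex D r) _ =>
      if_neg fun h : u.card = k => hmem (by rw [h]; exact k.2)]
    by_cases hlt : u.card < r
    · rw [subsetSum_eq_zero_of_card_lt (isHarmonic_basisLift b r ξ) hlt]
      simp
    · rw [Finset.mem_Icc, not_and, not_le] at hmem
      have hlt' := hmem (by omega)
      by_cases hev : Even (r : ℕ)
      · rw [if_pos hev] at hlt'
        omega
      · rw [if_neg hev] at hlt'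
        have hD' : u.card = D := by omega
        -- For odd `r` the deletions and the folded insertions at level `D` cancel, so no column at
        -- that level is needed.
        rw [if_pos hD', (Nat.not_even_iff_odd.1 hev).neg_one_pow, hD']
        by_cases hiD : D = i + 1
        · rw [if_pos hiD, if_pos (Or.inr ⟨rfl, hiD.symm⟩)]
          ring
        · have : (i : ℕ) ≠ D := fun h => hev (hi.2.2 h)
          rw [if_neg hiD, if_neg (show ¬ (D + 1 = i ∨ (D = D ∧ (i : ℕ) + 1 = D)) by omega),
            add_zero]

/-! ### The block diagonalization -/

/-- The embedding of the block algebra into the matrices indexed by the vertices. -/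
noncomputable def blockEmbedding (hodd : Odd D) :
    BlockAlgebra D →ₐ[ℂ] Matrix (FoldedVertex (2 * D)) (FoldedVertex (2 * D)) ℂ :=
  AlgHom.ofLinearMap
    { toFun := fun C => basisMatrix D b * repeatedBlocks D (ι := ι) C * (basisMatrix D b)ᴴ
      map_add' := fun A B => by rw [repeatedBlocks_add, Matrix.mul_add, Matrix.add_mul]
      map_smul' := fun c A => by
        rw [repeatedBlocks_smul, Matrix.mul_smul, Matrix.smul_mul, RingHom.id_apply] }
    (by
      change basisMatrix D b * repeatedBlocks D (ι := ι) 1 * (basisMatrix D b)ᴴ = 1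
      rw [repeatedBlocks_one, Matrix.mul_one, basisMatrix_mul_conjTranspose_self b hodd])
    (fun A B => by
      change basisMatrix D b * repeatedBlocks D (ι := ι) (A * B) * (basisMatrix D b)ᴴ =
        basisMatrix D b * repeatedBlocks D (ι := ι) A * (basisMatrix D b)ᴴ *
          (basisMatrix D b * repeatedBlocks D (ι := ι) B * (basisMatrix D b)ᴴ)
      rw [repeatedBlocks_mul]
      simp only [Matrix.mul_assoc]
      rw [← Matrix.mul_assoc (basisMatrix D b)ᴴ (basisMatrix D b),
        basisMatrix_conjTranspose_mul_self, Matrix.one_mul])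

theorem blockEmbedding_apply (hodd : Odd D) (C : BlockAlgebra D) :
    blockEmbedding b hodd C = basisMatrix D b * repeatedBlocks D (ι := ι) C * (basisMatrix D b)ᴴ :=
  rfl

theorem conjTranspose_mul_blockEmbedding_mul (hodd : Odd D) (C : BlockAlgebra D) :
    (basisMatrix D b)ᴴ * blockEmbedding b hodd C * basisMatrix D b =
      repeatedBlocks D (ι := ι) C := by
  rw [blockEmbedding_apply]
  simp only [Matrix.mul_assoc]
  rw [basisMatrix_conjTranspose_mul_self, Matrix.mul_one, ← Matrix.mul_assoc,
    basisMatrix_conjTranspose_mul_self, Matrix.one_mul]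

theorem blockEmbedding_injective (hodd : Odd D) : Function.Injective (blockEmbedding b hodd) := by
  have : ∀ r, Nonempty (ι r) := nonempty_index b hodd
  intro A B h
  refine repeatedBlocks_injective (ι := ι) ?_
  rw [← conjTranspose_mul_blockEmbedding_mul b hodd, h, conjTranspose_mul_blockEmbedding_mul]

theorem blockEmbedding_eq (hodd : Odd D) {C : BlockAlgebra D}
    {M : Matrix (FoldedVertex (2 * D)) (FoldedVertex (2 * D)) ℂ}
    (h : M * basisMatrix D b = basisMatrix D b * repeatedBlocks D (ι := ι) C) :
    blockEmbedding b hodd C = M := by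
  rw [blockEmbedding_apply, ← h, Matrix.mul_assoc, basisMatrix_mul_conjTranspose_self b hodd,
    Matrix.mul_one]

/-- One inclusion holds because the preimage of the Terwilliger algebra contains the blocks of the
generators and is thus everything; the other because all distance matrices are polynomials in the
first one. -/
theorem blockEmbedding_range (hD : 2 ≤ D) (hodd : Odd D) :
    (blockEmbedding b hodd).range =
      terwilligerAlgebra (foldedCube (2 * D)) (zero (2 * D)) := by
  have hA := blockEmbedding_eq b hodd (distMatrix_one_mul_basisMatrix b hD)
  have hE := fun i => blockEmbedding_eq b hodd (dualIdempotent_mul_basisMatrix b hD i)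
  refine le_antisymm ?_ (Algebra.adjoin_le (Set.union_subset ?_ ?_))
  · rw [← Algebra.map_top, Subalgebra.map_le]
    refine (subalgebra_eq_top _ (adjacencyBlocks D) ?_ (fun i => ?_)
      fun r i j h => adjacencyBlocks_ne_zero h).ge
    · rw [Subalgebra.mem_comap, hA]
      exact Algebra.subset_adjoin (Or.inl (Submodule.subset_span ⟨1, rfl⟩))
    · rw [Subalgebra.mem_comap, hE]
      exact Algebra.subset_adjoin (Or.inr (Submodule.subset_span ⟨i, rfl⟩))
  · have : boseMesner (foldedCube (2 * D)) ≤
        Subalgebra.toSubmodule (blockEmbedding b hodd).range := by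
      refine Submodule.span_le.2 ?_
      rintro _ ⟨i, rfl⟩
      exact Algebra.adjoin_le (Set.singleton_subset_iff.2 (AlgHom.mem_range _ |>.2 ⟨_, hA⟩))
        (distMatrix_mem_adjoin hD i)
    exact this
  · have : dualBoseMesner (foldedCube (2 * D)) (zero (2 * D)) ≤
        Subalgebra.toSubmodule (blockEmbedding b hodd).range := by
      refine Submodule.span_le.2 ?_
      rintro _ ⟨i, rfl⟩
      exact ⟨_, hE i⟩
    exact this

end Action

theorem mainTheorem5 (D : ℕ) (hD : 3 ≤ D) (hodd : Odd D)
    {ι : Fin D → Type*} [∀ r, Fintype (ι r)] [∀ r, DecidableEq (ι r)]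
    (b : ∀ r : Fin D, OrthonormalBasis (ι r) ℂ (lowestSpace D r)) :
    ((basisMatrix D b)ᴴ * basisMatrix D b = 1 ∧ basisMatrix D b * (basisMatrix D b)ᴴ = 1) ∧
    (∀ r : Fin D, (Fintype.card (ι r) : ℤ) =
      (2 * D).choose r - (if (r : ℕ) = 0 then 0 else (2 * D).choose (r - 1))) ∧
    ∃ Φ : terwilligerAlgebra (foldedCube (2 * D)) (FoldedVertex.zero (2 * D)) ≃ₐ[ℂ]
        ((r : Fin D) → Matrix (BlockIndex D r) (BlockIndex D r) ℂ),
      ∀ M : terwilligerAlgebra (foldedCube (2 * D)) (FoldedVertex.zero (2 * D)),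
        (basisMatrix D b)ᴴ * (M : Matrix (FoldedVertex (2 * D)) (FoldedVertex (2 * D)) ℂ) *
          basisMatrix D b = repeatedBlocks D (Φ M) := by
  refine ⟨⟨basisMatrix_conjTranspose_mul_self b, basisMatrix_mul_conjTranspose_self b hodd⟩,
    fun r => ?_, ?_⟩
  · rw [card_index_eq b hodd r, chooseDiff]
    split_ifs <;> simp
  · let e := (AlgEquiv.ofInjective (blockEmbedding b hodd) (blockEmbedding_injective b hodd)).trans
      (Subalgebra.equivOfEq _ _ (blockEmbedding_range b (by omega) hodd))
    refine ⟨e.symm, fun M => ?_⟩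
    have hM : blockEmbedding b hodd (e.symm M) = M := congrArg Subtype.val (e.apply_symm_apply M)
    rw [← conjTranspose_mul_blockEmbedding_mul b hodd, hM]
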